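/- For $s\in\mathbb R$ let $H^s=H^s(\mathbb R^2)$ be the space of tempered distributions $f$ with $\|f\|_s:=\big\|\mathcal F^{-1}\big((1+|\xi|^2)^{s/2}\widehat f\,\big)\big\|_{L^2(\mathbb R^2)}<\infty$, and for $g\in C^1(\mathbb R^2)$ let $\|g\|_{C^1}:=\|g\|_{L^\infty}+\|\partial_1 g\|_{L^\infty}+\|\partial_2 g\|_{L^\infty}\in[0,\infty]$. **Lemma (Reciprocal estimate).** For every $s>1$ and every $b>0$ there is a constant $C=C(s,b)<\infty$ such that for all complex-valued $h\in H^s(\mathbb R^2)$ and all real-valued $g\in H^s(\mathbb R^2)\cap C^1(\mathbb R^2)$ with $g(x)+b>\tfrac12 b$ for all $x\in\mathbb R^2$, $$\left\|\frac{h}{g+b}\right\|_{s}\le C\left(1+\|g\|_{C^1}^{s}+\|g\|_{s}^{s}\right)\|h\|_{s}.$$ The inequality is read in $[0,\infty]$, with $\|f\|_s=\infty$ for $f\notin H^s$ and $\infty\cdot 0=0$; in particular, $h/(g+b)\in H^s$ whenever $\|g\|_{C^1}<\infty$. -/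

import Mathlib

open MeasureTheory
open scoped ENNReal NNReal SchwartzMap

noncomputable section

/-- The Euclidean plane `ℝ²`. -/
abbrev Plane : Type := EuclideanSpace ℝ (Fin 2)

/-- The tempered distribution `u` is the regular distribution given by the function `f`,
i.e. `u(φ) = ∫ φ f` for every Schwartz function `φ`. -/
def Represents (f : Plane → ℂ) (u : 𝓢'(Plane, ℂ)) : Prop :=
  ∀ φ : 𝓢(Plane, ℂ), Integrable (fun x => φ x * f x) ∧ u φ = ∫ x, φ x * f x

/-- The extended `H^s` norm of a tempered distribution `u`: the `L²` norm of
`𝓕⁻¹ ((1 + |ξ|²)^(s/2) 𝓕 u)` if that distribution is an `L²` function, and `∞` otherwise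
(the infimum is over a set with at most one element). -/
def sobolevENorm (s : ℝ) (u : 𝓢'(Plane, ℂ)) : ℝ≥0∞ :=
  ⨅ (v : Lp ℂ 2 (volume : Measure Plane))
    (_ : TemperedDistribution.besselPotential Plane ℂ s u = v), ‖v‖ₑ

/-- The function `f` belongs to `H^s(ℝ²)`. -/
def MemHs (s : ℝ) (f : Plane → ℂ) : Prop :=
  ∃ u : 𝓢'(Plane, ℂ), Represents f u ∧ TemperedDistribution.MemSobolev s 2 u

/-- The extended norm `‖f‖_s` of a function `f`: the `H^s` norm of the (unique) tempered
distribution which `f` defines; it is `∞` if `f` is not in `H^s`. -/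
def hsENorm (s : ℝ) (f : Plane → ℂ) : ℝ≥0∞ :=
  ⨅ (u : 𝓢'(Plane, ℂ)) (_ : Represents f u), sobolevENorm s u

/-- The extended norm `‖g‖_{C¹} = ‖g‖_{L^∞} + ‖∂₁g‖_{L^∞} + ‖∂₂g‖_{L^∞}`. -/
def c1ENorm (g : Plane → ℝ) : ℝ≥0∞ :=
  eLpNorm g ∞ volume +
    ∑ i : Fin 2, eLpNorm (fun x => fderiv ℝ g x (EuclideanSpace.single i 1)) ∞ volume

theorem Represents.unique {f : Plane → ℂ} {u u' : 𝓢'(Plane, ℂ)}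
    (hu : Represents f u) (hu' : Represents f u') : u = u' := by
  ext φ
  rw [(hu φ).2, (hu' φ).2]

theorem hsENorm_eq_sobolevENorm {s : ℝ} {f : Plane → ℂ} {u : 𝓢'(Plane, ℂ)}
    (hu : Represents f u) : hsENorm s f = sobolevENorm s u := by
  apply le_antisymm
  · exact iInf₂_le u hu
  · refine le_iInf₂ fun u' hu' => ?_
    rw [hu.unique hu']

theorem sobolevENorm_eq_enorm {s : ℝ} {u : 𝓢'(Plane, ℂ)}
    {v : Lp ℂ 2 (volume : Measure Plane)}
    (hv : TemperedDistribution.besselPotential Plane ℂ s u = v) :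
    sobolevENorm s u = ‖v‖ₑ := by
  apply le_antisymm
  · exact iInf₂_le v hv
  · refine le_iInf₂ fun v' hv' => ?_
    have hker := Lp.ker_toTemperedDistributionCLM_eq_bot (F := ℂ)
      (μ := (volume : Measure Plane)) (p := 2)
    have hinj := LinearMap.ker_eq_bot.1 hker
    have h : v = v' := hinj (hv.symm.trans hv')
    rw [h]

/-- The extended norm is finite exactly on `H^s`. -/
theorem hsENorm_lt_top_iff {s : ℝ} {f : Plane → ℂ} : hsENorm s f < ∞ ↔ MemHs s f := by
  constructor
  · intro h
    obtain ⟨u, h⟩ := iInf_lt_iff.1 h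
    obtain ⟨hu, h⟩ := iInf_lt_iff.1 h
    obtain ⟨v, h⟩ := iInf_lt_iff.1 h
    obtain ⟨hv, h⟩ := iInf_lt_iff.1 h
    exact ⟨u, hu, v, hv⟩
  · rintro ⟨u, hu, v, hv⟩
    rw [hsENorm_eq_sobolevENorm hu, sobolevENorm_eq_enorm hv]
    exact enorm_lt_top

end

/-! Put G = g + b and u = h / G, so that G u = h with G ≥ b/2. All norms are computed as weighted L²
norms of Fourier transforms (`L2FourierPair.hsENorm_eq`). Since s > 1 in dimension two, the L¹ norm
of a transform is bounded by the H^s norm (`exists_lintegral_enorm_le_besselENorm`); in particular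
|h| is bounded by a multiple of ‖h‖_s.

For 1 < s ≤ 2, regularity is read off from second differences along the coordinate axes. G times the
second difference of u equals the second difference of h, minus u times the second difference of G,
minus products of first differences of G and of u (`norm_second_diff_le_of_reciprocal`). For step t
the first differences of G are at most Lt with L = ‖g‖_{C¹}, and those of u are controlled by first
differences of h and by min(1, Lt)|h| (`norm_sub_le_of_reciprocal`). Plancherel turns the squared L²
norms into integrals of trigonometric symbols, and integration against t^(-1-2s) dt turns these into
|ξ_i|^(2s). Rescaling t in the min(1, Lt) term yields L^(2s), hence L^s after a square root
(`exists_lintegral_abs_rpow_le_of_lt_two`). At s = 2 the integral in t diverges at 0; there t → 0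
and Fatou's lemma replace it (`exists_lintegral_abs_rpow_le_two`).

For s > 2 one derivative is gained at a time. Let m be a truncation of the Bessel weight and let w
have transform m û. Then G w has transform m ĥ minus the commutator of m with convolution by ĝ, and
that commutator costs ‖g‖_s ‖u‖_{s-1} (`exists_eLpNorm_commutator_le`). The lower bound on G gives
‖u‖_s ≲ ‖h‖_s + ‖g‖_s ‖u‖_{s-1} (`exists_besselENorm_reciprocal_step_le`). Induction then reduces s
to the range (1, 2], and since A L^(s-1) ≤ A^s + L^s the power s is preserved. -/

noncomputable section

open FourierTransform Set
open scoped Convolution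

/-! ### The L² Fourier transform as a relation between functions -/

/-- `k` is the `L²` Fourier transform of `f`, expressed by duality with Schwartz functions. -/
structure L2FourierPair (f k : Plane → ℂ) : Prop where
  memLp_left : MemLp f 2
  memLp_right : MemLp k 2
  integral_eq : ∀ φ : 𝓢(Plane, ℂ), ∫ x, (𝓕 φ) x * f x = ∫ ξ, φ ξ * k ξ

theorem ae_eq_of_forall_integral_schwartz_mul_eq {f f' : Plane → ℂ}
    (hf : LocallyIntegrable f) (hf' : LocallyIntegrable f')
    (h : ∀ φ : 𝓢(Plane, ℂ), ∫ x, φ x * f x = ∫ x, φ x * f' x) : f =ᵐ[volume] f' := by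
  have key : ∀ᵐ x ∂(volume : Measure Plane), (f - f') x = 0 := by
    refine ae_eq_zero_of_integral_contDiff_smul_eq_zero (hf.sub hf') fun g hg hgc => ?_
    have hg₁ : HasCompactSupport (Complex.ofRealCLM ∘ g) := hgc.comp_left rfl
    have hg₂ : ContDiff ℝ (⊤ : ℕ∞) (Complex.ofRealCLM ∘ g) := by fun_prop
    have e := h (hg₁.toSchwartzMap hg₂)
    have i1 := hf.integrable_smul_left_of_hasCompactSupport hg.continuous hgc
    have i2 := hf'.integrable_smul_left_of_hasCompactSupport hg.continuous hgc
    have e' : ∫ x, g x • f x = ∫ x, g x • f' x := by simpa using e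
    simp only [Pi.sub_apply, smul_sub]
    rw [integral_sub i1 i2, e', sub_self]
  filter_upwards [key] with x hx
  simpa [sub_eq_zero] using hx

theorem integrable_schwartz_mul {f : Plane → ℂ} (hf : MemLp f 2) (φ : 𝓢(Plane, ℂ)) :
    Integrable (fun x => φ x * f x) :=
  (φ.memLp 2).integrable_mul hf

/-- Testing against a smooth bump equal to 1 on a given compact set shows integrability there. This
makes the function recoverable almost everywhere from its distribution. -/
theorem Represents.locallyIntegrable {f : Plane → ℂ} {u : 𝓢'(Plane, ℂ)} (h : Represents f u) :
    LocallyIntegrable f := by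
  rw [← locallyIntegrableOn_univ]
  rw [locallyIntegrableOn_iff isClosed_univ.isLocallyClosed]
  intro K _ hK
  obtain ⟨g, hg1, hg2, hg3⟩ : ∃ g : Plane → ℝ, ContDiff ℝ (⊤ : ℕ∞) g ∧ HasCompactSupport g ∧
      ∀ x ∈ K, g x = 1 := by
    obtain ⟨R, hR⟩ := hK.isBounded.subset_ball (0 : Plane)
    let b : ContDiffBump (0 : Plane) := ⟨|R| + 1, |R| + 2, by positivity, by linarith⟩
    refine ⟨b, b.contDiff, b.hasCompactSupport, fun x hx => b.one_of_mem_closedBall ?_⟩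
    have h1 := hR hx
    rw [Metric.mem_ball] at h1
    rw [Metric.mem_closedBall]
    show dist x 0 ≤ |R| + 1
    linarith [le_abs_self R]
  have hg₁ : HasCompactSupport (Complex.ofRealCLM ∘ g) := hg2.comp_left rfl
  have hg₂ : ContDiff ℝ (⊤ : ℕ∞) (Complex.ofRealCLM ∘ g) := by fun_prop
  have e := (h (hg₁.toSchwartzMap hg₂)).1
  refine (e.integrableOn (s := K)).congr_fun (fun x hx => ?_) hK.measurableSet
  simp [hg3 x hx]

theorem Represents.congr {f f' : Plane → ℂ} {u : 𝓢'(Plane, ℂ)} (h : Represents f u)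
    (hf : f =ᵐ[volume] f') : Represents f' u := by
  intro φ
  have e : (fun x => φ x * f x) =ᵐ[volume] fun x => φ x * f' x := by
    filter_upwards [hf] with x hx
    rw [hx]
  exact ⟨(h φ).1.congr e, (h φ).2.trans (integral_congr_ae e)⟩

theorem represents_toLp {f : Plane → ℂ} (hf : MemLp f 2) :
    Represents f (hf.toLp f : Lp ℂ 2 (volume : Measure Plane)) := by
  intro φ
  refine ⟨integrable_schwartz_mul hf φ, ?_⟩
  rw [Lp.toTemperedDistribution_apply]
  refine integral_congr_ae ?_
  filter_upwards [hf.coeFn_toLp] with x hx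
  simp [hx]

namespace L2FourierPair

theorem of_Lp (F : Lp ℂ 2 (volume : Measure Plane)) : L2FourierPair F (𝓕 F : Lp ℂ 2 _) := by
  refine ⟨Lp.memLp F, Lp.memLp _, fun φ => ?_⟩
  have h := congrArg (fun u : 𝓢'(Plane, ℂ) => u φ) (Lp.fourier_toTemperedDistribution_eq F)
  simpa [TemperedDistribution.fourier_apply] using h

theorem congr {f k f' k' : Plane → ℂ} (h : L2FourierPair f k) (hf : f =ᵐ[volume] f')
    (hk : k =ᵐ[volume] k') : L2FourierPair f' k' := by
  refine ⟨(memLp_congr_ae hf).1 h.1, (memLp_congr_ae hk).1 h.2, fun φ => ?_⟩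
  have e1 : (fun x => (𝓕 φ) x * f x) =ᵐ[volume] fun x => (𝓕 φ) x * f' x := by
    filter_upwards [hf] with x hx
    rw [hx]
  have e2 : (fun x => φ x * k x) =ᵐ[volume] fun x => φ x * k' x := by
    filter_upwards [hk] with x hx
    rw [hx]
  rw [← integral_congr_ae e1, ← integral_congr_ae e2, h.3]

theorem exists_right {f : Plane → ℂ} (hf : MemLp f 2) : ∃ k, L2FourierPair f k :=
  ⟨_, (of_Lp (hf.toLp f)).congr hf.coeFn_toLp (Filter.EventuallyEq.refl _ _)⟩

theorem exists_left {k : Plane → ℂ} (hk : MemLp k 2) : ∃ f, L2FourierPair f k := by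
  refine ⟨_, (of_Lp (𝓕⁻ (hk.toLp k))).congr (Filter.EventuallyEq.refl _ _) ?_⟩
  rw [fourier_fourierInv_eq]
  exact hk.coeFn_toLp

theorem unique_right {f k k' : Plane → ℂ} (h : L2FourierPair f k) (h' : L2FourierPair f k') :
    k =ᵐ[volume] k' := by
  refine ae_eq_of_forall_integral_schwartz_mul_eq (h.2.locallyIntegrable (by norm_num))
    (h'.2.locallyIntegrable (by norm_num)) fun φ => ?_
  rw [← h.3, ← h'.3]

/-- Only local integrability is asked of `f'`, so the lemma applies to a function known merely
through its distribution, and to a continuous inverse transform. -/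
theorem unique_left {f f' k : Plane → ℂ} (h : L2FourierPair f k) (hf' : LocallyIntegrable f')
    (h' : ∀ φ : 𝓢(Plane, ℂ), ∫ x, (𝓕 φ) x * f' x = ∫ ξ, φ ξ * k ξ) :
    f =ᵐ[volume] f' := by
  refine ae_eq_of_forall_integral_schwartz_mul_eq (h.1.locallyIntegrable (by norm_num))
    hf' fun φ => ?_
  have h1 := h.3 (𝓕⁻ φ)
  have h2 := h' (𝓕⁻ φ)
  rw [fourier_fourierInv_eq] at h1 h2
  rw [h1, h2]

theorem fourier_toLp {f k : Plane → ℂ} (h : L2FourierPair f k) :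
    𝓕 (h.1.toLp f) = h.2.toLp k := by
  apply Lp.ext
  refine (unique_right ((of_Lp (h.1.toLp f)).congr h.1.coeFn_toLp (Filter.EventuallyEq.refl _ _))
    h).trans h.2.coeFn_toLp.symm

theorem eLpNorm_eq {f k : Plane → ℂ} (h : L2FourierPair f k) : eLpNorm f 2 = eLpNorm k 2 := by
  have e := Lp.norm_fourier_eq (h.1.toLp f)
  rw [h.fourier_toLp, Lp.norm_toLp, Lp.norm_toLp,
    ENNReal.toReal_eq_toReal_iff' h.2.2.ne h.1.2.ne] at e
  exact e.symm

theorem add {f k f' k' : Plane → ℂ} (h : L2FourierPair f k) (h' : L2FourierPair f' k') :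
    L2FourierPair (fun x => f x + f' x) (fun x => k x + k' x) := by
  refine ⟨h.1.add h'.1, h.2.add h'.2, fun φ => ?_⟩
  simp only [mul_add]
  rw [integral_add (integrable_schwartz_mul h.1 _) (integrable_schwartz_mul h'.1 _),
    integral_add (integrable_schwartz_mul h.2 _) (integrable_schwartz_mul h'.2 _), h.3, h'.3]

theorem const_mul {f k : Plane → ℂ} (h : L2FourierPair f k) (c : ℂ) :
    L2FourierPair (fun x => c * f x) (fun x => c * k x) := by
  refine ⟨h.1.const_mul c, h.2.const_mul c, fun φ => ?_⟩
  simp only [mul_left_comm _ c]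
  rw [integral_const_mul, integral_const_mul, h.3]

theorem comp_add_right {f k : Plane → ℂ} (h : L2FourierPair f k) (y : Plane) :
    L2FourierPair (fun x => f (x + y))
      (fun ξ => Complex.exp ((2 * Real.pi * inner ℝ y ξ : ℝ) * Complex.I) * k ξ) := by
  have hmp := measurePreserving_add_right (volume : Measure Plane) y
  refine ⟨h.1.comp_measurePreserving hmp, ?_, fun φ => ?_⟩
  · refine h.2.of_le (AEStronglyMeasurable.mul ?_ h.2.1) (.of_forall fun ξ => ?_)
    · exact Continuous.aestronglyMeasurable (by fun_prop)
    · rw [norm_mul, Complex.norm_exp_ofReal_mul_I, one_mul]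
  · have e1 : ∫ x, (𝓕 φ) x * f (x + y) = ∫ x, (𝓕 φ) (x - y) * f x := by
      have e2 := integral_add_right_eq_self (μ := volume) (fun x => (𝓕 φ) (x - y) * f x) y
      simpa using e2
    -- The test function is chosen so that its transform is the translate of `𝓕 φ`; it is `φ` times
    -- a character, which `e3` verifies.
    have h2 := h.3 (𝓕⁻ ((𝓕 φ).compSubConstCLM ℂ y))
    rw [fourier_fourierInv_eq] at h2
    rw [e1]
    refine h2.trans (integral_congr_ae (.of_forall fun ξ => ?_))
    have e3 : (𝓕⁻ ((𝓕 φ).compSubConstCLM ℂ y)) ξ =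
        Complex.exp ((2 * Real.pi * inner ℝ y ξ : ℝ) * Complex.I) * φ ξ := by
      have e4 : (φ : Plane → ℂ) ξ = (𝓕⁻ (𝓕 φ)) ξ := by rw [fourierInv_fourier_eq]
      rw [e4, SchwartzMap.fourierInv_coe, SchwartzMap.fourierInv_coe, Real.fourierInv_eq',
        Real.fourierInv_eq', ← integral_const_mul]
      have e5 := integral_add_right_eq_self (μ := volume)
        (fun v => Complex.exp (((2 * Real.pi * inner ℝ v ξ : ℝ) : ℂ) * Complex.I) •
          ((𝓕 φ).compSubConstCLM ℂ y) v) y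
      refine e5.symm.trans (integral_congr_ae (.of_forall fun v => ?_))
      simp only [SchwartzMap.compSubConstCLM_apply, add_sub_cancel_right, smul_eq_mul,
        inner_add_left]
      rw [← mul_assoc, ← Complex.exp_add]
      congr 2
      push_cast
      ring
    simp only [e3]
    ring

end L2FourierPair

/-! ### Fourier inversion for integrable transforms -/

/-- Fourier inversion for integrable Fourier transforms, by duality. -/
theorem integral_fourier_mul_fourierInv {k : Plane → ℂ} (hk : Integrable k) (φ : 𝓢(Plane, ℂ)) :
    ∫ x, (𝓕 φ) x * 𝓕⁻ k x = ∫ ξ, φ ξ * k ξ := by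
  have h := VectorFourier.integral_fourierIntegral_smul_eq_flip (L := innerₗ Plane)
    (μ := (volume : Measure Plane)) (ν := volume) (f := fun x => (𝓕 φ) (-x)) (g := k)
    Real.continuous_fourierChar continuous_inner ((𝓕 φ).integrable.comp_neg) hk
  have e1 : ∀ ξ, VectorFourier.fourierIntegral Real.fourierChar volume (innerₗ Plane)
      (fun x => (𝓕 φ) (-x)) ξ = φ ξ := by
    intro ξ
    have e4 : (φ : Plane → ℂ) ξ = (𝓕⁻ (𝓕 φ)) ξ := by rw [fourierInv_fourier_eq]
    rw [e4, SchwartzMap.fourierInv_coe, Real.fourierInv_eq_fourier_comp_neg]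
    rfl
  simp only [e1, smul_eq_mul] at h
  rw [h, ← integral_neg_eq_self]
  refine integral_congr_ae (.of_forall fun x => ?_)
  simp only [Real.fourierInv_eq_fourier_neg, neg_neg]
  congr 1
  have : (innerₗ Plane).flip = innerₗ Plane := by
    ext a b
    simp
  rw [this]
  rfl

theorem continuous_fourierInv {k : Plane → ℂ} (hk : Integrable k) : Continuous (𝓕⁻ k) := by
  have h : Continuous (𝓕 k) := VectorFourier.fourierIntegral_continuous
    Real.continuous_fourierChar continuous_inner hk
  have e : 𝓕⁻ k = fun x => 𝓕 k (-x) := funext fun x => Real.fourierInv_eq_fourier_neg k x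
  rw [e]
  exact h.comp continuous_neg

theorem L2FourierPair.ae_eq_fourierInv {f k : Plane → ℂ} (h : L2FourierPair f k)
    (hk : Integrable k) :
    f =ᵐ[volume] 𝓕⁻ k :=
  h.unique_left (continuous_fourierInv hk).locallyIntegrable (integral_fourier_mul_fourierInv hk)

theorem L2FourierPair.ae_enorm_le {f k : Plane → ℂ} (h : L2FourierPair f k) (hk : Integrable k) :
    ∀ᵐ x, ‖f x‖ₑ ≤ ∫⁻ ξ, ‖k ξ‖ₑ := by
  filter_upwards [h.ae_eq_fourierInv hk] with x hx
  rw [hx, Real.fourierInv_eq']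
  refine (enorm_integral_le_lintegral_enorm _).trans (lintegral_mono fun ξ => ?_)
  rw [smul_eq_mul, enorm_mul, ← ofReal_norm, Complex.norm_exp_ofReal_mul_I]
  simp

/-! ### Bessel weights and the H^s norm on the Fourier side -/

theorem eLpNorm_two_sq_eq_lintegral {α E : Type*} [MeasurableSpace α] {μ : Measure α}
    [NormedAddCommGroup E] (f : α → E) : eLpNorm f 2 μ ^ 2 = ∫⁻ x, ‖f x‖ₑ ^ 2 ∂μ := by
  rw [eLpNorm_eq_lintegral_rpow_enorm_toReal (by norm_num) (by norm_num),
    ← ENNReal.rpow_natCast, ← ENNReal.rpow_mul]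
  simp

theorem lintegral_mul_sq_le {α : Type*} [MeasurableSpace α] {μ : Measure α} {f g : α → ℝ≥0∞}
    (hf : AEMeasurable f μ) (hg : AEMeasurable g μ) :
    (∫⁻ x, f x * g x ∂μ) ^ 2 ≤ (∫⁻ x, f x ^ 2 ∂μ) * ∫⁻ x, g x ^ 2 ∂μ := by
  have h := ENNReal.lintegral_mul_le_Lp_mul_Lq μ Real.HolderConjugate.two_two hf hg
  have h2 := pow_le_pow_left' h 2
  refine h2.trans (le_of_eq ?_)
  rw [mul_pow, ← ENNReal.rpow_natCast, ← ENNReal.rpow_natCast, ← ENNReal.rpow_mul,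
    ← ENNReal.rpow_mul]
  simp

/-- The Bessel weight `(1 + |ξ|²)^(s/2)`. -/
def besselWeight (s : ℝ) (ξ : Plane) : ℝ := (1 + ‖ξ‖ ^ 2) ^ (s / 2)

theorem besselWeight_pos (s : ℝ) (ξ : Plane) : 0 < besselWeight s ξ :=
  Real.rpow_pos_of_pos (by positivity) _

theorem continuous_besselWeight (s : ℝ) : Continuous (besselWeight s) := by
  unfold besselWeight
  exact Continuous.rpow_const (by fun_prop) fun x => Or.inl (by positivity)

theorem besselWeight_mono {s t : ℝ} (h : s ≤ t) (ξ : Plane) :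
    besselWeight s ξ ≤ besselWeight t ξ :=
  Real.rpow_le_rpow_of_exponent_le (by nlinarith [sq_nonneg ‖ξ‖]) (by linarith)

theorem besselWeight_add (s t : ℝ) (ξ : Plane) :
    besselWeight (s + t) ξ = besselWeight s ξ * besselWeight t ξ := by
  unfold besselWeight
  rw [← Real.rpow_add (by positivity)]
  ring_nf

theorem besselWeight_zero (ξ : Plane) : besselWeight 0 ξ = 1 := by simp [besselWeight]

theorem besselWeight_sq (s : ℝ) (ξ : Plane) : besselWeight s ξ ^ 2 = (1 + ‖ξ‖ ^ 2) ^ s := by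
  unfold besselWeight
  rw [← Real.rpow_mul_natCast (by positivity)]
  norm_num

/-- The weighted `L²` norm of a Fourier transform. -/
def besselENorm (s : ℝ) (k : Plane → ℂ) : ℝ≥0∞ :=
  eLpNorm (fun ξ => (besselWeight s ξ : ℂ) * k ξ) 2

theorem enorm_besselWeight_mul (s : ℝ) (k : Plane → ℂ) (ξ : Plane) :
    ‖(besselWeight s ξ : ℂ) * k ξ‖ₑ = ENNReal.ofReal (besselWeight s ξ) * ‖k ξ‖ₑ := by
  rw [enorm_mul, ← ofReal_norm, Complex.norm_of_nonneg (besselWeight_pos s ξ).le]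

theorem besselENorm_sq (s : ℝ) (k : Plane → ℂ) :
    besselENorm s k ^ 2 = ∫⁻ ξ, ENNReal.ofReal ((1 + ‖ξ‖ ^ 2) ^ s) * ‖k ξ‖ₑ ^ 2 := by
  rw [besselENorm, eLpNorm_two_sq_eq_lintegral]
  refine lintegral_congr fun ξ => ?_
  rw [enorm_besselWeight_mul, mul_pow, ← ENNReal.ofReal_pow (besselWeight_pos s ξ).le,
    besselWeight_sq]

theorem besselENorm_mono {s t : ℝ} (h : s ≤ t) (k : Plane → ℂ) :
    besselENorm s k ≤ besselENorm t k := by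
  refine eLpNorm_mono_enorm fun ξ => ?_
  rw [enorm_besselWeight_mul, enorm_besselWeight_mul]
  gcongr
  exact besselWeight_mono h ξ

theorem besselENorm_zero (k : Plane → ℂ) : besselENorm 0 k = eLpNorm k 2 := by
  simp [besselENorm, besselWeight_zero]

theorem aestronglyMeasurable_besselWeight_mul (s : ℝ) {k : Plane → ℂ}
    (hk : AEStronglyMeasurable k) :
    AEStronglyMeasurable (fun ξ => (besselWeight s ξ : ℂ) * k ξ) :=
  (Complex.continuous_ofReal.comp (continuous_besselWeight s)).aestronglyMeasurable.mul hk

theorem hasTemperateGrowth_besselWeight (s : ℝ) :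
    (fun ξ => (besselWeight s ξ : ℂ)).HasTemperateGrowth := by
  unfold besselWeight
  fun_prop

/-- Finiteness puts the weighted transform in L²; its inverse transform is then the Bessel potential
of `f`, and Plancherel gives equality of norms. -/
theorem L2FourierPair.hsENorm_eq {s : ℝ} {f k : Plane → ℂ} (h : L2FourierPair f k)
    (hk : besselENorm s k < ∞) : hsENorm s f = besselENorm s k := by
  have hm : MemLp (fun ξ => (besselWeight s ξ : ℂ) * k ξ) 2 :=
    ⟨aestronglyMeasurable_besselWeight_mul s h.2.1, hk⟩
  rw [hsENorm_eq_sobolevENorm (represents_toLp h.1),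
    sobolevENorm_eq_enorm (v := 𝓕⁻ (hm.toLp _))]
  · rw [← ofReal_norm, ← Lp.norm_fourier_eq (𝓕⁻ (hm.toLp _)), fourier_fourierInv_eq, ofReal_norm,
      Lp.enorm_toLp]
    rfl
  · rw [TemperedDistribution.besselPotential, TemperedDistribution.fourierMultiplierCLM_apply,
      Lp.fourier_toTemperedDistribution_eq, h.fourier_toLp,
      ← Lp.fourierInv_toTemperedDistribution_eq]
    congr 1
    ext φ
    rw [TemperedDistribution.smulLeftCLM_apply_apply, Lp.toTemperedDistribution_apply,
      Lp.toTemperedDistribution_apply]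
    refine integral_congr_ae ?_
    filter_upwards [h.2.coeFn_toLp, hm.coeFn_toLp] with ξ h1 h2
    rw [h1, h2]
    change (SchwartzMap.smulLeftCLM ℂ (fun x => (besselWeight s x : ℂ)) φ) ξ • k ξ = _
    rw [SchwartzMap.smulLeftCLM_apply_apply (hasTemperateGrowth_besselWeight s)]
    simp only [smul_eq_mul]
    ring

/-- If `W` is the weighted transform in L², dividing by the weight, which is at least 1 because s ≥
0, keeps it in L². The L² function with that transform and `f` define the same distribution, so they
agree almost everywhere. -/
theorem MemHs.exists_fourierPair {s : ℝ} (hs : 0 ≤ s) {f : Plane → ℂ} (hf : MemHs s f) :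
    ∃ k, L2FourierPair f k ∧ besselENorm s k < ∞ := by
  obtain ⟨u, hu, hm⟩ := hf
  obtain ⟨W, hW⟩ := TemperedDistribution.memSobolev_iff_exists_smulLeftCLM_fourier.1 hm
  change TemperedDistribution.smulLeftCLM ℂ (fun x => (besselWeight s x : ℂ)) (𝓕 u) = _ at hW
  let k : Plane → ℂ := fun ξ => (besselWeight (-s) ξ : ℂ) * W ξ
  have hwk : ∀ ξ, (besselWeight s ξ : ℂ) * k ξ = W ξ := by
    intro ξ
    simp only [k]
    rw [← mul_assoc, ← Complex.ofReal_mul, ← besselWeight_add]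
    simp [besselWeight_zero]
  have hk2 : MemLp k 2 := by
    refine (Lp.memLp W).of_le (aestronglyMeasurable_besselWeight_mul _ (Lp.memLp W).1)
      (.of_forall fun ξ => ?_)
    rw [norm_mul, Complex.norm_of_nonneg (besselWeight_pos _ _).le]
    refine mul_le_of_le_one_left (norm_nonneg _) ?_
    rw [← besselWeight_zero ξ]
    exact besselWeight_mono (by linarith) ξ
  have hFu : 𝓕 u = (hk2.toLp k : 𝓢'(Plane, ℂ)) := by
    have e := congrArg (TemperedDistribution.smulLeftCLM ℂ fun ξ => (besselWeight (-s) ξ : ℂ)) hW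
    rw [TemperedDistribution.smulLeftCLM_smulLeftCLM_apply (hasTemperateGrowth_besselWeight s)
      (hasTemperateGrowth_besselWeight (-s))] at e
    have e1 : ((fun ξ => (besselWeight s ξ : ℂ)) *
        fun ξ => (besselWeight (-s) ξ : ℂ)) = fun _ => 1 := by
      ext ξ
      have := besselWeight_add s (-s) ξ
      rw [add_neg_cancel, besselWeight_zero] at this
      simp only [Pi.mul_apply]
      rw [← Complex.ofReal_mul]
      rw [← this]
      simp
    rw [e1, TemperedDistribution.smulLeftCLM_const, one_smul] at e
    rw [e]
    ext φ
    rw [TemperedDistribution.smulLeftCLM_apply_apply, Lp.toTemperedDistribution_apply,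
      Lp.toTemperedDistribution_apply]
    refine integral_congr_ae ?_
    filter_upwards [hk2.coeFn_toLp] with ξ h1
    rw [h1, SchwartzMap.smulLeftCLM_apply_apply (hasTemperateGrowth_besselWeight (-s))]
    simp only [smul_eq_mul, k]
    ring
  obtain ⟨F, hF⟩ := L2FourierPair.exists_left hk2
  have hfF : F =ᵐ[volume] f := by
    refine hF.unique_left hu.locallyIntegrable fun φ => ?_
    rw [← (hu (𝓕 φ)).2, ← TemperedDistribution.fourier_apply, hFu, Lp.toTemperedDistribution_apply]
    refine integral_congr_ae ?_
    filter_upwards [hk2.coeFn_toLp] with ξ h1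
    rw [h1, smul_eq_mul]
  refine ⟨k, hF.congr hfF (Filter.EventuallyEq.refl _ _), ?_⟩
  simp only [besselENorm, hwk]
  exact (Lp.memLp W).2

/-- Cauchy–Schwarz against the weight of order -s, whose square (1 + |ξ|²)^(-s) is integrable over
the plane because 2s > 2. -/
theorem exists_lintegral_enorm_le_besselENorm {s : ℝ} (hs : 1 < s) :
    ∃ C : ℝ≥0, ∀ k : Plane → ℂ, AEStronglyMeasurable k →
      ∫⁻ ξ, ‖k ξ‖ₑ ≤ C * besselENorm s k := by
  have hint : Integrable (fun ξ : Plane => (1 + ‖ξ‖ ^ 2) ^ (-(2 * s) / 2)) := by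
    refine integrable_rpow_neg_one_add_norm_sq ?_
    simp only [finrank_euclideanSpace, Fintype.card_fin]
    push_cast
    linarith
  have hfin : eLpNorm (besselWeight (-s)) 2 < ∞ := by
    have : eLpNorm (besselWeight (-s)) 2 ^ 2 < ∞ := by
      rw [eLpNorm_two_sq_eq_lintegral]
      refine lt_of_le_of_lt (le_of_eq (lintegral_congr fun ξ => ?_)) hint.2
      rw [← enorm_pow, besselWeight_sq]
      ring_nf
    exact (ENNReal.pow_lt_top_iff.1 this).resolve_right (by norm_num)
  refine ⟨(eLpNorm (besselWeight (-s)) 2).toNNReal, fun k hk => ?_⟩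
  rw [ENNReal.coe_toNNReal hfin.ne]
  have h := lintegral_mul_sq_le (μ := volume)
    (continuous_besselWeight (-s)).aestronglyMeasurable.enorm
    (aestronglyMeasurable_besselWeight_mul s hk).enorm
  rw [← eLpNorm_two_sq_eq_lintegral, ← eLpNorm_two_sq_eq_lintegral, ← mul_pow] at h
  have h2 := (ENNReal.pow_le_pow_left_iff two_ne_zero).1 h
  refine le_trans (le_of_eq (lintegral_congr fun ξ => ?_)) h2
  rw [enorm_besselWeight_mul, ← mul_assoc, ← ofReal_norm (besselWeight (-s) ξ), Real.norm_eq_abs,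
    abs_of_pos (besselWeight_pos _ _), ← ENNReal.ofReal_mul (besselWeight_pos _ _).le,
    ← besselWeight_add]
  simp [besselWeight_zero]

theorem integrable_of_besselENorm_lt_top {s : ℝ} (hs : 1 < s) {k : Plane → ℂ}
    (hk : AEStronglyMeasurable k) (h : besselENorm s k < ∞) : Integrable k := by
  obtain ⟨C, hC⟩ := exists_lintegral_enorm_le_besselENorm hs
  exact ⟨hk, (hC k hk).trans_lt (ENNReal.mul_lt_top ENNReal.coe_lt_top h)⟩

/-! ### Young's inequality and transforms of products -/

/-- Young's inequality `L¹ * L² → L²`. -/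
theorem lintegral_sq_lintegral_sub_mul_le {f a : Plane → ℝ≥0∞} (hf : AEMeasurable f)
    (ha : AEMeasurable a) :
    ∫⁻ ξ, (∫⁻ η, f (ξ - η) * a η) ^ 2 ≤ (∫⁻ η, a η) ^ 2 * ∫⁻ ξ, f ξ ^ 2 := by
  have hsub : ∀ ξ : Plane, AEMeasurable (fun η => f (ξ - η)) := fun ξ =>
    hf.comp_quasiMeasurePreserving (quasiMeasurePreserving_sub_left volume ξ)
  -- Split a = a^(1/2) · a^(1/2), give one half to f, and apply Cauchy–Schwarz; Tonelli then
  -- finishes.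
  have hpt : ∀ ξ : Plane, (∫⁻ η, f (ξ - η) * a η) ^ 2 ≤
      (∫⁻ η, f (ξ - η) ^ 2 * a η) * ∫⁻ η, a η := by
    intro ξ
    have hh : ∀ x : ℝ≥0∞, x ^ (1 / 2 : ℝ) * x ^ (1 / 2 : ℝ) = x := by
      intro x
      rw [← ENNReal.rpow_add_of_nonneg _ _ (by norm_num) (by norm_num)]
      norm_num
    have h := lintegral_mul_sq_le (μ := volume) (f := fun η => f (ξ - η) * a η ^ (1 / 2 : ℝ))
      (g := fun η => a η ^ (1 / 2 : ℝ)) ((hsub ξ).mul (ha.pow_const _)) (ha.pow_const _)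
    simp only [mul_assoc, hh, mul_pow, pow_two (a _ ^ (1 / 2 : ℝ))] at h
    exact h
  refine (lintegral_mono hpt).trans ?_
  have hm : AEMeasurable (fun p : Plane × Plane => f (p.1 - p.2) ^ 2 * a p.2)
      (volume.prod volume) :=
    ((hf.comp_quasiMeasurePreserving (quasiMeasurePreserving_sub volume volume)).pow_const 2).mul
      ha.comp_snd
  rw [lintegral_mul_const'' _ hm.lintegral_prod_right', lintegral_lintegral_swap hm]
  have : ∀ η : Plane, ∫⁻ ξ, f (ξ - η) ^ 2 * a η = (∫⁻ ξ, f ξ ^ 2) * a η := by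
    intro η
    have hm' : AEMeasurable (fun ξ => f (ξ - η)) := hf.comp_quasiMeasurePreserving
      (measurePreserving_sub_right volume η).quasiMeasurePreserving
    rw [lintegral_mul_const'' _ (hm'.pow_const 2),
      lintegral_sub_right_eq_self (fun ξ => f ξ ^ 2) η]
  simp only [this]
  rw [lintegral_const_mul'' _ ha, pow_two]
  exact le_of_eq (by ring)

theorem lintegral_sq_lintegral_sub_mul_le' {f a : Plane → ℝ≥0∞} (hf : AEMeasurable f)
    (ha : AEMeasurable a) :
    ∫⁻ ξ, (∫⁻ η, f (ξ - η) * a η) ^ 2 ≤ (∫⁻ ξ, f ξ) ^ 2 * ∫⁻ η, a η ^ 2 := by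
  refine le_trans (le_of_eq (lintegral_congr fun ξ => ?_))
    (lintegral_sq_lintegral_sub_mul_le ha hf)
  rw [← lintegral_sub_left_eq_self (fun η => f (ξ - η) * a η) ξ]
  simp only [sub_sub_cancel]
  simp only [mul_comm]

theorem memLp_two_convolution {g w : Plane → ℂ} (hg : Integrable g) (hw : MemLp w 2)
    (hw1 : Integrable w) :
    MemLp (g ⋆[ContinuousLinearMap.mul ℂ ℂ] w) 2 := by
  refine ⟨(hg.integrable_convolution _ hw1).1, ?_⟩
  have h : eLpNorm (g ⋆[ContinuousLinearMap.mul ℂ ℂ] w) 2 ^ 2 < ∞ := by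
    rw [eLpNorm_two_sq_eq_lintegral]
    have hy := lintegral_sq_lintegral_sub_mul_le (f := fun x => ‖w x‖ₑ) (a := fun x => ‖g x‖ₑ)
      hw.1.enorm hg.1.enorm
    refine lt_of_le_of_lt (lintegral_mono fun ξ => ?_) (hy.trans_lt ?_)
    · gcongr
      refine (enorm_integral_le_lintegral_enorm _).trans (lintegral_mono fun η => ?_)
      simp [enorm_mul, mul_comm]
    · rw [← eLpNorm_two_sq_eq_lintegral]
      exact ENNReal.mul_lt_top (ENNReal.pow_lt_top hg.2) (ENNReal.pow_lt_top hw.2)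
  exact (ENNReal.pow_lt_top_iff.1 h).resolve_right (by norm_num)

/-- An integrable transform `k` makes `g` essentially bounded, so the product stays in L². Both
factors are inverse transforms of integrable functions, hence their product is the inverse transform
of the convolution. -/
theorem L2FourierPair.mul {g k w l : Plane → ℂ} (hg : L2FourierPair g k) (hw : L2FourierPair w l)
    (hk : Integrable k) (hl : Integrable l) :
    L2FourierPair (fun x => g x * w x) (k ⋆[ContinuousLinearMap.mul ℂ ℂ] l) := by
  refine ⟨?_, memLp_two_convolution hk hw.2 hl, fun φ => ?_⟩
  · refine hw.1.of_le_mul (c := (∫⁻ ξ, ‖k ξ‖ₑ).toReal) (hg.1.1.mul hw.1.1) ?_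
    filter_upwards [hg.ae_enorm_le hk] with x hx
    rw [norm_mul]
    gcongr
    rw [← toReal_enorm]
    exact ENNReal.toReal_mono hk.2.ne hx
  · rw [← integral_fourier_mul_fourierInv (hk.integrable_convolution _ hl)]
    refine integral_congr_ae ?_
    filter_upwards [hg.ae_eq_fourierInv hk, hw.ae_eq_fourierInv hl] with x h1 h2
    simp only [h1, h2, Real.fourierInv_eq_fourier_neg, Real.fourier_mul_convolution_eq hk hl]

/-! ### Commutator estimate and the gain of one derivative for s > 2 -/

theorem eLpNorm_two_le_of_tendsto_of_forall_le {α E : Type*} [MeasurableSpace α] {μ : Measure α}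
    [NormedAddCommGroup E] {f : ℕ → α → E} {F : α → E} {K : ℝ≥0∞}
    (hf : ∀ n, AEStronglyMeasurable (f n) μ)
    (hlim : ∀ᵐ x ∂μ, Filter.Tendsto (fun n => f n x) Filter.atTop (nhds (F x)))
    (hK : ∀ n, eLpNorm (f n) 2 μ ≤ K) : eLpNorm F 2 μ ≤ K :=
  (Lp.eLpNorm_lim_le_liminf_eLpNorm hf F hlim).trans
    (Filter.liminf_le_of_frequently_le' (Filter.Frequently.of_forall hK))

theorem ennreal_add_sq_le (a b : ℝ≥0∞) : (a + b) ^ 2 ≤ 2 * (a ^ 2 + b ^ 2) := by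
  have h := ENNReal.rpow_add_le_mul_rpow_add_rpow a b (p := 2) (by norm_num)
  norm_num at h
  exact h

theorem besselWeight_eq_rpow (s : ℝ) (ξ : Plane) : besselWeight s ξ = besselWeight 1 ξ ^ s := by
  unfold besselWeight
  rw [← Real.rpow_mul (by positivity)]
  ring_nf

/-- The weight of order 1 is √(1 + |ξ|²); after squaring, the triangle inequality for |ξ| and |η| |ξ
- η| ≤ ⟨η⟩⟨ξ - η⟩ suffice. -/
theorem besselWeight_one_le_add (ξ η : Plane) :
    besselWeight 1 ξ ≤ besselWeight 1 η + besselWeight 1 (ξ - η) := by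
  have h0 := besselWeight_pos 1 ξ
  have h1 := besselWeight_pos 1 η
  have h2 := besselWeight_pos 1 (ξ - η)
  have e0 := besselWeight_sq 1 ξ
  have e1 := besselWeight_sq 1 η
  have e2 := besselWeight_sq 1 (ξ - η)
  rw [Real.rpow_one] at e0 e1 e2
  have hn : ‖ξ‖ ≤ ‖η‖ + ‖ξ - η‖ := by
    simpa using norm_add_le η (ξ - η)
  have l1 : ‖η‖ ≤ besselWeight 1 η := by
    refine abs_le_of_sq_le_sq' ?_ h1.le |>.2
    linarith
  have l2 : ‖ξ - η‖ ≤ besselWeight 1 (ξ - η) := by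
    refine abs_le_of_sq_le_sq' ?_ h2.le |>.2
    linarith
  have hp : ‖η‖ * ‖ξ - η‖ ≤ besselWeight 1 η * besselWeight 1 (ξ - η) := by gcongr
  refine abs_le_of_sq_le_sq' ?_ (by positivity) |>.2
  have hsq : ‖ξ‖ ^ 2 ≤ (‖η‖ + ‖ξ - η‖) ^ 2 := by gcongr
  nlinarith

/-- Convexity of the power function: this is Bernoulli's inequality at b/a - 1, multiplied by a^s.
-/
theorem rpow_sub_rpow_le {a b s : ℝ} (ha : 0 < a) (hb : 0 < b) (hs : 1 ≤ s) :
    a ^ s - b ^ s ≤ s * a ^ (s - 1) * (a - b) := by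
  have h := one_add_mul_self_le_rpow_one_add (s := b / a - 1) (p := s)
    (by have := div_pos hb ha; linarith) hs
  rw [add_sub_cancel, Real.div_rpow hb.le ha.le] at h
  have has : 0 < a ^ s := Real.rpow_pos_of_pos ha _
  rw [le_div_iff₀ has] at h
  rw [Real.rpow_sub_one ha.ne']
  have e : s * (a ^ s / a) * (a - b) = -(s * (b / a - 1) * a ^ s) := by
    field_simp
    ring
  rw [e]
  linarith

theorem add_rpow_le_two_rpow_mul {p q r : ℝ} (hp : 0 ≤ p) (hq : 0 ≤ q) (hr : 0 ≤ r) :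
    (p + q) ^ r ≤ 2 ^ r * (p ^ r + q ^ r) := by
  have h1 : (p + q) ^ r ≤ (2 * max p q) ^ r := by
    gcongr
    linarith [le_max_left p q, le_max_right p q]
  rw [Real.mul_rpow (by norm_num) (le_max_of_le_left hp)] at h1
  refine h1.trans (mul_le_mul_of_nonneg_left ?_ (by positivity))
  have := Real.rpow_nonneg hp r
  have := Real.rpow_nonneg hq r
  rcases max_cases p q with h | h <;> rw [h.1] <;> linarith

/-- Convexity bounds the difference by s · max^(s-1) · ⟨ξ - η⟩, and max ≤ ⟨ξ - η⟩ + ⟨η⟩. One factor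
⟨ξ - η⟩ always comes out, so at most s - 1 powers fall on η: this is the gained derivative. -/
theorem abs_besselWeight_sub_le {s : ℝ} (hs : 1 ≤ s) (ξ η : Plane) :
    |besselWeight s ξ - besselWeight s η| ≤ s * 2 ^ (s - 1) *
      (besselWeight s (ξ - η) + besselWeight 1 (ξ - η) * besselWeight (s - 1) η) := by
  have h0 := besselWeight_pos 1 ξ
  have h1 := besselWeight_pos 1 η
  have h2 := besselWeight_pos 1 (ξ - η)
  have a1 := besselWeight_one_le_add ξ η
  have a2 := besselWeight_one_le_add η ξ
  rw [show besselWeight 1 (η - ξ) = besselWeight 1 (ξ - η) by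
    simp [besselWeight, norm_sub_rev]] at a2
  have es : besselWeight s (ξ - η) = besselWeight 1 (ξ - η) * besselWeight 1 (ξ - η) ^ (s - 1) := by
    rw [← besselWeight_eq_rpow, ← besselWeight_add]
    ring_nf
  rw [es, besselWeight_eq_rpow s ξ, besselWeight_eq_rpow s η, besselWeight_eq_rpow (s - 1) η]
  generalize besselWeight 1 ξ = a at *
  generalize besselWeight 1 η = b at *
  generalize besselWeight 1 (ξ - η) = c at *
  have key : ∀ x y : ℝ, 0 < x → 0 < y → x - y ≤ c → x ≤ c + b →
      x ^ s - y ^ s ≤ s * 2 ^ (s - 1) * (c * c ^ (s - 1) + c * b ^ (s - 1)) := by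
    intro x y hx hy hxy hxc
    refine (rpow_sub_rpow_le hx hy hs).trans ?_
    have hx' : x ^ (s - 1) ≤ (c + b) ^ (s - 1) := by
      gcongr
    calc s * x ^ (s - 1) * (x - y) ≤ s * x ^ (s - 1) * c := by gcongr
      _ ≤ s * (2 ^ (s - 1) * (c ^ (s - 1) + b ^ (s - 1))) * c := by
        gcongr
        exact hx'.trans (add_rpow_le_two_rpow_mul h2.le h1.le (by linarith))
      _ = _ := by ring
  rw [abs_le]
  constructor
  · have := key b a h1 h0 (by linarith) (by linarith)
    linarith
  · exact key a b h0 h1 (by linarith) (by linarith)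

theorem besselENorm_besselWeight_mul (s t : ℝ) (k : Plane → ℂ) :
    besselENorm s (fun ξ => (besselWeight t ξ : ℂ) * k ξ) = besselENorm (s + t) k := by
  unfold besselENorm
  congr 1
  ext ξ
  rw [besselWeight_add]
  push_cast
  ring

/-- The kernel of the commutator is m(ξ) - m(ξ - t). By the preceding bound it splits into two
convolutions: ⟨t⟩^s k in L² against l in L¹, and ⟨t⟩ k in L¹ against ⟨·⟩^(s-1) l in L². Both L¹
norms come from the H^(s-1) embedding, which needs s - 1 > 1. The bound is uniform in every m that
varies no more than the weight. -/
theorem exists_eLpNorm_commutator_le {s : ℝ} (hs : 2 < s) :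
    ∃ C : ℝ≥0, ∀ (m : Plane → ℝ) (k l : Plane → ℂ), Continuous m →
      (∃ B, ∀ ξ, |m ξ| ≤ B) →
      (∀ ξ η, |m ξ - m η| ≤ |besselWeight s ξ - besselWeight s η|) →
      Integrable k → Integrable l →
      eLpNorm (fun ξ => (m ξ : ℂ) * (k ⋆[ContinuousLinearMap.mul ℂ ℂ] l) ξ -
        (k ⋆[ContinuousLinearMap.mul ℂ ℂ] fun η => (m η : ℂ) * l η) ξ) 2 ≤
        C * (besselENorm s k * besselENorm (s - 1) l) := by
  obtain ⟨C₁, hC₁⟩ := exists_lintegral_enorm_le_besselENorm (s := s - 1) (by linarith)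
  set C₀ : ℝ≥0 := Real.toNNReal (s * 2 ^ (s - 1)) with hC₀
  refine ⟨2 * C₀ * C₁, fun m k l hm ⟨B, hB⟩ hml hk hl => ?_⟩
  have hmc : Continuous fun ξ => (m ξ : ℂ) := Complex.continuous_ofReal.comp hm
  have hl' : Integrable fun η => (m η : ℂ) * l η :=
    hl.bdd_mul (c := B) hmc.aestronglyMeasurable (.of_forall fun ξ => by simpa using hB ξ)
  have hwm : ∀ t, AEMeasurable fun ξ => ENNReal.ofReal (besselWeight t ξ) := fun t =>
    (continuous_besselWeight t).measurable.ennreal_ofReal.aemeasurable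
  set F₁ : Plane → ℝ≥0∞ := fun t => ENNReal.ofReal (besselWeight s t) * ‖k t‖ₑ
  set F₂ : Plane → ℝ≥0∞ := fun t => ENNReal.ofReal (besselWeight 1 t) * ‖k t‖ₑ
  set a₂ : Plane → ℝ≥0∞ := fun t => ENNReal.ofReal (besselWeight (s - 1) t) * ‖l t‖ₑ
  have hF₁ : AEMeasurable F₁ := (hwm s).mul hk.1.enorm
  have hF₂ : AEMeasurable F₂ := (hwm 1).mul hk.1.enorm
  have ha₁ : AEMeasurable fun t => ‖l t‖ₑ := hl.1.enorm
  have ha₂ : AEMeasurable a₂ := (hwm (s - 1)).mul hl.1.enorm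
  have hpt : ∀ᵐ ξ, ‖(m ξ : ℂ) * (k ⋆[ContinuousLinearMap.mul ℂ ℂ] l) ξ -
      (k ⋆[ContinuousLinearMap.mul ℂ ℂ] fun η => (m η : ℂ) * l η) ξ‖ₑ ≤
      C₀ * ((∫⁻ t, ‖l (ξ - t)‖ₑ * F₁ t) + ∫⁻ t, a₂ (ξ - t) * F₂ t) := by
    filter_upwards [hk.ae_convolution_exists (ContinuousLinearMap.mul ℂ ℂ) hl,
      hk.ae_convolution_exists (ContinuousLinearMap.mul ℂ ℂ) hl'] with ξ h1 h2
    have e : (m ξ : ℂ) * (k ⋆[ContinuousLinearMap.mul ℂ ℂ] l) ξ -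
        (k ⋆[ContinuousLinearMap.mul ℂ ℂ] fun η => (m η : ℂ) * l η) ξ =
        ∫ t, ((m ξ - m (ξ - t) : ℝ) : ℂ) * (k t * l (ξ - t)) := by
      simp only [convolution_def]
      rw [← integral_const_mul, ← integral_sub (h1.const_mul _) h2]
      refine integral_congr_ae (.of_forall fun t => ?_)
      simp only [ContinuousLinearMap.mul_apply']
      push_cast
      ring
    rw [e]
    have hsubm : AEMeasurable fun t => ‖l (ξ - t)‖ₑ :=
      ha₁.comp_quasiMeasurePreserving (quasiMeasurePreserving_sub_left volume ξ)
    have hsum := lintegral_add_left' (μ := volume) (hsubm.mul hF₁) fun t => a₂ (ξ - t) * F₂ t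
    simp only [Pi.mul_apply] at hsum
    rw [← hsum, ← lintegral_const_mul' _ _ ENNReal.coe_ne_top]
    refine (enorm_integral_le_lintegral_enorm _).trans (lintegral_mono fun t => ?_)
    have hw := (hml ξ (ξ - t)).trans (abs_besselWeight_sub_le (by linarith) ξ (ξ - t))
    rw [sub_sub_cancel] at hw
    have hw' : ‖((m ξ - m (ξ - t) : ℝ) : ℂ)‖ₑ ≤ C₀ * (ENNReal.ofReal (besselWeight s t) +
        ENNReal.ofReal (besselWeight 1 t) * ENNReal.ofReal (besselWeight (s - 1) (ξ - t))) := by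
      rw [← ofReal_norm, Complex.norm_real, Real.norm_eq_abs]
      refine (ENNReal.ofReal_le_ofReal hw).trans (le_of_eq ?_)
      rw [ENNReal.ofReal_mul (by positivity), ENNReal.ofReal_add (besselWeight_pos _ _).le
        (mul_pos (besselWeight_pos _ _) (besselWeight_pos _ _)).le,
        ENNReal.ofReal_mul (besselWeight_pos _ _).le]
      rfl
    rw [enorm_mul, enorm_mul]
    calc _ ≤ C₀ * (ENNReal.ofReal (besselWeight s t) + ENNReal.ofReal (besselWeight 1 t) *
          ENNReal.ofReal (besselWeight (s - 1) (ξ - t))) * (‖k t‖ₑ * ‖l (ξ - t)‖ₑ) := by gcongr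
      _ = _ := by simp only [F₁, F₂, a₂]; ring
  have hF₁n : ∫⁻ t, F₁ t ^ 2 = besselENorm s k ^ 2 := by
    rw [besselENorm, eLpNorm_two_sq_eq_lintegral]
    simp only [enorm_besselWeight_mul, F₁]
  have ha₂n : ∫⁻ t, a₂ t ^ 2 = besselENorm (s - 1) l ^ 2 := by
    rw [besselENorm, eLpNorm_two_sq_eq_lintegral]
    simp only [enorm_besselWeight_mul, a₂]
  have hl1 : ∫⁻ t, ‖l t‖ₑ ≤ C₁ * besselENorm (s - 1) l := hC₁ l hl.1
  have hF₂1 : ∫⁻ t, F₂ t ≤ C₁ * besselENorm s k := by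
    have := hC₁ _ (aestronglyMeasurable_besselWeight_mul 1 hk.1)
    rw [besselENorm_besselWeight_mul, sub_add_cancel] at this
    simpa only [enorm_besselWeight_mul] using this
  have hA := lintegral_sq_lintegral_sub_mul_le' ha₁ hF₁
  have hB' := lintegral_sq_lintegral_sub_mul_le ha₂ hF₂
  rw [hF₁n] at hA
  rw [ha₂n] at hB'
  have hAm : AEMeasurable fun ξ => ∫⁻ t, ‖l (ξ - t)‖ₑ * F₁ t :=
    ((ha₁.comp_quasiMeasurePreserving (quasiMeasurePreserving_sub volume volume)).mul
      hF₁.comp_snd).lintegral_prod_right'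
  refine (ENNReal.pow_le_pow_left_iff two_ne_zero).1 ?_
  rw [eLpNorm_two_sq_eq_lintegral]
  calc _ ≤ ∫⁻ ξ, (2 * C₀ ^ 2 : ℝ≥0∞) * ((∫⁻ t, ‖l (ξ - t)‖ₑ * F₁ t) ^ 2 +
        (∫⁻ t, a₂ (ξ - t) * F₂ t) ^ 2) := by
        refine lintegral_mono_ae ?_
        filter_upwards [hpt] with ξ hξ
        refine (pow_le_pow_left' hξ 2).trans ?_
        rw [mul_pow, mul_comm (2 : ℝ≥0∞), mul_assoc]
        gcongr
        exact ennreal_add_sq_le _ _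
    _ = 2 * C₀ ^ 2 * ((∫⁻ ξ, (∫⁻ t, ‖l (ξ - t)‖ₑ * F₁ t) ^ 2) +
        ∫⁻ ξ, (∫⁻ t, a₂ (ξ - t) * F₂ t) ^ 2) := by
        rw [lintegral_const_mul' _ _ (by finiteness), lintegral_add_left' (hAm.pow_const 2)]
    _ ≤ 2 * C₀ ^ 2 * ((C₁ * besselENorm (s - 1) l) ^ 2 * besselENorm s k ^ 2 +
        (C₁ * besselENorm s k) ^ 2 * besselENorm (s - 1) l ^ 2) := by
        gcongr
        · exact hA.trans (by gcongr)
        · exact hB'.trans (by gcongr)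
    _ = _ := by
        push_cast
        ring

/-- The multiplier is applied to the equation (g + b) u = h, and g + b ≥ b/2 inverts the
multiplication in L². Only the commutator with g is left over, and it sees u in H^(s-1) only. -/
theorem exists_besselENorm_reciprocal_step_le {s b : ℝ} (hs : 2 < s) (hb : 0 < b) :
    ∃ C : ℝ≥0, ∀ (h u : Plane → ℂ) (g : Plane → ℝ) (kh kg ku : Plane → ℂ),
      L2FourierPair h kh → L2FourierPair (fun x => (g x : ℂ)) kg → L2FourierPair u ku →
      (∀ x, b / 2 ≤ g x + b) → (∀ x, ((g x + b : ℝ) : ℂ) * u x = h x) →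
      besselENorm s kg < ∞ → besselENorm (s - 1) ku < ∞ →
      besselENorm s ku ≤ C * (besselENorm s kh + besselENorm s kg * besselENorm (s - 1) ku) := by
  obtain ⟨C, hC⟩ := exists_eLpNorm_commutator_le hs
  refine ⟨Real.toNNReal (2 / b) * (1 + C), fun h u g kh kg ku hh hg hu hgb hu_eq hgs hus => ?_⟩
  have hkg : Integrable kg := integrable_of_besselENorm_lt_top (by linarith) hg.2.1 hgs
  have hku : Integrable ku := integrable_of_besselENorm_lt_top (by linarith) hu.2.1 hus
  -- At this point u is only known to lie in H^(s-1), so the weight is truncated at N: m û is then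
  -- in L², and Fatou's lemma removes the truncation from bounds uniform in N.
  let m : ℕ → Plane → ℝ := fun N ξ => min (besselWeight s ξ) N
  have hm0 : ∀ N ξ, 0 ≤ m N ξ := fun N ξ => le_min (besselWeight_pos s ξ).le (Nat.cast_nonneg N)
  have hmc : ∀ N, Continuous (m N) := fun N => (continuous_besselWeight s).min continuous_const
  have hmcc : ∀ N, Continuous fun ξ => (m N ξ : ℂ) := fun N =>
    Complex.continuous_ofReal.comp (hmc N)
  have hmB : ∀ N ξ, |m N ξ| ≤ N := fun N ξ => by
    rw [abs_of_nonneg (hm0 N ξ)]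
    exact min_le_right _ _
  refine eLpNorm_two_le_of_tendsto_of_forall_le (f := fun N ξ => (m N ξ : ℂ) * ku ξ)
    (fun N => (hmcc N).aestronglyMeasurable.mul hu.2.1) (.of_forall fun ξ => ?_) fun N => ?_
  · refine tendsto_const_nhds.congr' ?_
    filter_upwards [Filter.eventually_ge_atTop ⌈besselWeight s ξ⌉₊] with N hN
    simp only [m]
    rw [min_eq_left (Nat.ceil_le.1 hN)]
  have hmu : MemLp (fun ξ => (m N ξ : ℂ) * ku ξ) 2 := by
    refine hu.2.of_le_mul (c := N) ((hmcc N).aestronglyMeasurable.mul hu.2.1)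
      (.of_forall fun ξ => ?_)
    rw [norm_mul, Complex.norm_real, Real.norm_eq_abs]
    gcongr
    exact hmB N ξ
  have hmu1 : Integrable fun ξ => (m N ξ : ℂ) * ku ξ :=
    hku.bdd_mul (c := N) (hmcc N).aestronglyMeasurable (.of_forall fun ξ => by simpa using hmB N ξ)
  obtain ⟨w, hw⟩ := L2FourierPair.exists_left hmu
  have hgu := (hg.mul hu hkg hku).add (hu.const_mul b)
  have hgw := (hg.mul hw hkg hmu1).add (hw.const_mul b)
  have hkh := hgu.unique_right (hh.congr (.of_forall fun x => by
    rw [← hu_eq x]; push_cast; ring) (Filter.EventuallyEq.refl _ _))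
  set R : Plane → ℂ := fun ξ => (m N ξ : ℂ) * (kg ⋆[ContinuousLinearMap.mul ℂ ℂ] ku) ξ -
        (kg ⋆[ContinuousLinearMap.mul ℂ ℂ] fun η => (m N η : ℂ) * ku η) ξ with hR
  have hRb : eLpNorm R 2 ≤ C * (besselENorm s kg * besselENorm (s - 1) ku) :=
    hC (m N) kg ku (hmc N) ⟨N, hmB N⟩ (fun ξ η => by
      simpa using abs_min_sub_min_le_max (besselWeight s ξ) (N : ℝ) (besselWeight s η) N) hkg hku
  have hmh : eLpNorm (fun ξ => (m N ξ : ℂ) * kh ξ) 2 ≤ besselENorm s kh := by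
    refine eLpNorm_mono_real (g := fun ξ => ‖(besselWeight s ξ : ℂ) * kh ξ‖) (fun ξ => ?_) |>.trans
      (le_of_eq (eLpNorm_norm _))
    rw [norm_mul, norm_mul, Complex.norm_of_nonneg (hm0 N ξ),
      Complex.norm_of_nonneg (besselWeight_pos s ξ).le]
    gcongr
    exact min_le_left _ _
  have hRm : AEStronglyMeasurable R :=
    ((hmcc N).aestronglyMeasurable.mul (hkg.integrable_convolution _ hku).1).sub
      (hkg.integrable_convolution _ hmu1).1
  have h1 : eLpNorm w 2 ≤ ENNReal.ofReal (2 / b) *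
      eLpNorm (fun x => (g x : ℂ) * w x + b * w x) 2 := by
    refine eLpNorm_le_mul_eLpNorm_of_ae_le_mul (.of_forall fun x => ?_) 2
    rw [← add_mul, norm_mul, ← Complex.ofReal_add, Complex.norm_real, Real.norm_eq_abs]
    have h2 : 1 ≤ 2 / b * |g x + b| := by
      rw [div_mul_eq_mul_div, le_div_iff₀ hb]
      linarith [hgb x, le_abs_self (g x + b)]
    rw [← mul_assoc]
    exact le_mul_of_one_le_left (norm_nonneg _) h2
  have h2 : eLpNorm (fun x => (g x : ℂ) * w x + b * w x) 2 ≤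
      besselENorm s kh + C * (besselENorm s kg * besselENorm (s - 1) ku) := by
    rw [hgw.eLpNorm_eq]
    -- The transform of (g + b) w is m ĥ minus the commutator, because ĝ * û + b û = ĥ almost
    -- everywhere.
    have e : (fun ξ => (kg ⋆[ContinuousLinearMap.mul ℂ ℂ] fun η => (m N η : ℂ) * ku η) ξ +
        b * ((m N ξ : ℂ) * ku ξ)) =ᵐ[volume] (fun ξ => (m N ξ : ℂ) * kh ξ) - R := by
      filter_upwards [hkh] with ξ hξ
      simp only [Pi.sub_apply, hR, ← hξ]
      ring
    rw [eLpNorm_congr_ae e]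
    exact (eLpNorm_sub_le ((hmcc N).aestronglyMeasurable.mul hh.2.1) hRm (by norm_num)).trans
      (add_le_add hmh hRb)
  rw [← hw.eLpNorm_eq]
  refine h1.trans ?_
  rw [ENNReal.coe_mul, mul_assoc]
  refine mul_le_mul' le_rfl (h2.trans ?_)
  push_cast
  rw [add_mul, one_mul, mul_add, add_comm (C * besselENorm s kh : ℝ≥0∞), ← add_assoc]
  refine le_trans ?_ le_self_add
  gcongr
  exact le_self_add

/-! ### First and second differences under the Fourier transform -/

/-- The symbol `|exp(2πiθ) - 1|²` of the first difference. -/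
def diffSymbol (θ : ℝ) : ℝ := 2 - 2 * Real.cos (2 * Real.pi * θ)

theorem diffSymbol_nonneg (θ : ℝ) : 0 ≤ diffSymbol θ := by
  unfold diffSymbol
  linarith [Real.cos_le_one (2 * Real.pi * θ)]

theorem diffSymbol_le_four (θ : ℝ) : diffSymbol θ ≤ 4 := by
  unfold diffSymbol
  linarith [Real.neg_one_le_cos (2 * Real.pi * θ)]

theorem diffSymbol_le_sq (θ : ℝ) : diffSymbol θ ≤ (2 * Real.pi * θ) ^ 2 := by
  unfold diffSymbol
  linarith [Real.one_sub_sq_div_two_le_cos (x := 2 * Real.pi * θ)]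

theorem diffSymbol_neg (θ : ℝ) : diffSymbol (-θ) = diffSymbol θ := by
  simp [diffSymbol]

theorem diffSymbol_abs (θ : ℝ) : diffSymbol |θ| = diffSymbol θ := by
  rcases abs_choice θ with h | h <;> rw [h]
  exact diffSymbol_neg θ

theorem continuous_diffSymbol : Continuous diffSymbol := by
  unfold diffSymbol
  fun_prop

theorem enorm_sq_eq_ofReal {E : Type*} [NormedAddCommGroup E] (z : E) :
    ‖z‖ₑ ^ 2 = ENNReal.ofReal (‖z‖ ^ 2) := by
  rw [← ofReal_norm, ENNReal.ofReal_pow (norm_nonneg _)]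

theorem normSq_exp_sub_one (θ : ℝ) :
    ‖Complex.exp ((2 * Real.pi * θ : ℝ) * Complex.I) - 1‖ ^ 2 = diffSymbol θ := by
  rw [← Complex.normSq_eq_norm_sq, Complex.exp_mul_I, Complex.normSq_apply]
  simp only [Complex.sub_re, Complex.add_re, Complex.mul_re, Complex.I_re, Complex.I_im,
    Complex.sub_im, Complex.add_im, Complex.mul_im, Complex.one_re, Complex.one_im,
    Complex.cos_ofReal_re, Complex.sin_ofReal_re, Complex.cos_ofReal_im, Complex.sin_ofReal_im,
    diffSymbol]
  nlinarith [Real.sin_sq_add_cos_sq (2 * Real.pi * θ)]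

theorem exp_add_exp_neg_sub_two (θ : ℝ) :
    Complex.exp ((2 * Real.pi * θ : ℝ) * Complex.I) +
      Complex.exp ((2 * Real.pi * (-θ) : ℝ) * Complex.I) - 2 = -(diffSymbol θ : ℂ) := by
  rw [diffSymbol, mul_neg, Complex.ofReal_neg, neg_mul]
  push_cast
  rw [Complex.cos]
  ring_nf

theorem L2FourierPair.lintegral_diff_sq {f k : Plane → ℂ} (h : L2FourierPair f k) (y : Plane) :
    ∫⁻ x, ‖f (x + y) - f x‖ₑ ^ 2 =
      ∫⁻ ξ, ENNReal.ofReal (diffSymbol (inner ℝ y ξ)) * ‖k ξ‖ₑ ^ 2 := by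
  have hp := ((h.comp_add_right y).add (h.const_mul (-1))).eLpNorm_eq
  have hp2 := congrArg (fun x => x ^ 2) hp
  simp only [eLpNorm_two_sq_eq_lintegral] at hp2
  refine Eq.trans (lintegral_congr fun x => ?_) (hp2.trans (lintegral_congr fun ξ => ?_))
  · congr 2
    ring
  · rw [← normSq_exp_sub_one, ← enorm_sq_eq_ofReal, ← mul_pow, ← enorm_mul]
    congr 2
    push_cast
    ring

theorem L2FourierPair.lintegral_second_diff_sq {f k : Plane → ℂ} (h : L2FourierPair f k)
    (y : Plane) :
    ∫⁻ x, ‖f (x + y) - 2 * f x + f (x - y)‖ₑ ^ 2 =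
      ∫⁻ ξ, ENNReal.ofReal (diffSymbol (inner ℝ y ξ) ^ 2) * ‖k ξ‖ₑ ^ 2 := by
  have hp := (((h.comp_add_right y).add (h.const_mul (-2))).add (h.comp_add_right (-y))).eLpNorm_eq
  have hp2 := congrArg (fun x => x ^ 2) hp
  simp only [eLpNorm_two_sq_eq_lintegral] at hp2
  refine Eq.trans (lintegral_congr fun x => ?_) (hp2.trans (lintegral_congr fun ξ => ?_))
  · congr 2
    rw [sub_eq_add_neg x y]
    ring
  · have e := exp_add_exp_neg_sub_two (inner ℝ y ξ)
    have e2 : ENNReal.ofReal (diffSymbol (inner ℝ y ξ) ^ 2) =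
        ‖-(diffSymbol (inner ℝ y ξ) : ℂ)‖ₑ ^ 2 := by
      rw [enorm_sq_eq_ofReal, norm_neg, Complex.norm_real, Real.norm_eq_abs, sq_abs]
    rw [e2, ← mul_pow, ← enorm_mul, ← e, inner_neg_left]
    congr 2
    ring

/-! ### Pointwise inequalities for differences of a quotient -/

section Pointwise

variable {β δ M : ℝ} {G₀ G₁ G₂ : ℝ} {u₀ u₁ u₂ : ℂ}

/-- For δ ≤ 1 use G₁(u₁ - u₀) = (G₁u₁ - G₀u₀) - (G₁ - G₀)u₀; for δ ≥ 1 bound u₁ and u₀ separately.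
The cap at 1 is what later makes the integral over large steps converge. -/
theorem norm_sub_le_of_reciprocal (hβ : 0 < β) (h₀ : β ≤ G₀) (h₁ : β ≤ G₁)
    (hδ : |G₁ - G₀| ≤ δ) :
    ‖u₁ - u₀‖ ≤ β⁻¹ * ‖(G₁ : ℂ) * u₁ - G₀ * u₀‖ +
      (2 * β⁻¹ + (β⁻¹) ^ 2) * (min 1 δ * ‖(G₀ : ℂ) * u₀‖) := by
  have hδ0 : 0 ≤ δ := (abs_nonneg _).trans hδ
  have hB : 0 < β⁻¹ := inv_pos.2 hβ
  have inv_le : ∀ {G : ℝ} {z : ℂ}, β ≤ G → ‖z‖ ≤ β⁻¹ * ‖(G : ℂ) * z‖ := by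
    intro G z hG
    rw [norm_mul, Complex.norm_of_nonneg (hβ.le.trans hG), ← mul_assoc]
    refine le_mul_of_one_le_left (norm_nonneg _) ?_
    rw [inv_mul_eq_div, le_div_iff₀ hβ, one_mul]
    exact hG
  have n0 := norm_nonneg ((G₀ : ℂ) * u₀)
  rcases le_total δ 1 with h | h
  · rw [min_eq_right h]
    have e : (G₁ : ℂ) * (u₁ - u₀) = ((G₁ : ℂ) * u₁ - G₀ * u₀) - ((G₁ - G₀ : ℝ) : ℂ) * u₀ := by
      push_cast
      ring
    have e1 : ‖(G₁ : ℂ) * (u₁ - u₀)‖ ≤ ‖(G₁ : ℂ) * u₁ - G₀ * u₀‖ +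
        δ * (β⁻¹ * ‖(G₀ : ℂ) * u₀‖) := by
      rw [e]
      refine (norm_sub_le _ _).trans ?_
      rw [norm_mul, Complex.norm_real, Real.norm_eq_abs]
      gcongr
      exact inv_le h₀
    refine (inv_le h₁).trans ((mul_le_mul_of_nonneg_left e1 hB.le).trans ?_)
    have : 0 ≤ 2 * β⁻¹ * (δ * ‖(G₀ : ℂ) * u₀‖) := by positivity
    linarith
  · rw [min_eq_left h]
    have e1 : ‖(G₁ : ℂ) * u₁‖ ≤ ‖(G₁ : ℂ) * u₁ - G₀ * u₀‖ + ‖(G₀ : ℂ) * u₀‖ := by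
      simpa using norm_add_le ((G₁ : ℂ) * u₁ - G₀ * u₀) ((G₀ : ℂ) * u₀)
    have e2 := mul_le_mul_of_nonneg_left e1 hB.le
    have e3 := inv_le (z := u₁) h₁
    have e4 := inv_le (z := u₀) h₀
    have : 0 ≤ (β⁻¹) ^ 2 * ‖(G₀ : ℂ) * u₀‖ := by positivity
    linarith [norm_sub_le u₁ u₀]

/-- A discrete Leibniz rule centred at the middle point. Only G₀ is inverted, and u₀ is bounded by
β⁻¹M, so the second difference of G may be measured in L². -/
theorem norm_second_diff_le_of_reciprocal (hβ : 0 < β) (h₀ : β ≤ G₀)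
    (hδ₁ : |G₁ - G₀| ≤ δ) (hδ₂ : |G₂ - G₀| ≤ δ) (hM : ‖(G₀ : ℂ) * u₀‖ ≤ M) :
    ‖u₁ - 2 * u₀ + u₂‖ ≤ β⁻¹ * (‖(G₁ : ℂ) * u₁ - 2 * (G₀ * u₀) + G₂ * u₂‖ +
      β⁻¹ * M * |G₁ - 2 * G₀ + G₂| + δ * ‖u₁ - u₀‖ + δ * ‖u₂ - u₀‖) := by
  have hδ0 : 0 ≤ δ := (abs_nonneg _).trans hδ₁
  have hB : 0 < β⁻¹ := inv_pos.2 hβ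
  have inv_le : ∀ {G : ℝ} {z : ℂ}, β ≤ G → ‖z‖ ≤ β⁻¹ * ‖(G : ℂ) * z‖ := by
    intro G z hG
    rw [norm_mul, Complex.norm_of_nonneg (hβ.le.trans hG), ← mul_assoc]
    refine le_mul_of_one_le_left (norm_nonneg _) ?_
    rw [inv_mul_eq_div, le_div_iff₀ hβ, one_mul]
    exact hG
  have hu0 : ‖u₀‖ ≤ β⁻¹ * M := (inv_le h₀).trans (by gcongr)
  refine (inv_le h₀).trans (mul_le_mul_of_nonneg_left ?_ hB.le)
  have e : (G₀ : ℂ) * (u₁ - 2 * u₀ + u₂) = ((G₁ : ℂ) * u₁ - 2 * (G₀ * u₀) + G₂ * u₂) -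
      u₀ * ((G₁ - 2 * G₀ + G₂ : ℝ) : ℂ) - ((G₁ - G₀ : ℝ) : ℂ) * (u₁ - u₀) -
      ((G₂ - G₀ : ℝ) : ℂ) * (u₂ - u₀) := by
    push_cast
    ring
  rw [e]
  refine (norm_sub_le _ _).trans (add_le_add ((norm_sub_le _ _).trans (add_le_add
    ((norm_sub_le _ _).trans (add_le_add le_rfl ?_)) ?_)) ?_)
  · rw [norm_mul, Complex.norm_real, Real.norm_eq_abs]
    gcongr
  · rw [norm_mul, Complex.norm_real, Real.norm_eq_abs]
    gcongr
  · rw [norm_mul, Complex.norm_real, Real.norm_eq_abs]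
    gcongr

end Pointwise

theorem lintegral_diffSymbol_le_of_reciprocal {β δ : ℝ} {h u : Plane → ℂ} {g : Plane → ℝ}
    {kh ku : Plane → ℂ} {y : Plane}
    (hβ : 0 < β) (hh : L2FourierPair h kh) (hu : L2FourierPair u ku)
    (hG : ∀ x, β ≤ g x) (hu_eq : ∀ x, (g x : ℂ) * u x = h x)
    (hδ : ∀ x, |g (x + y) - g x| ≤ δ) :
    ∫⁻ ξ, ENNReal.ofReal (diffSymbol (inner ℝ y ξ)) * ‖ku ξ‖ₑ ^ 2 ≤
      ENNReal.ofReal (2 * (β⁻¹) ^ 2) *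
        (∫⁻ ξ, ENNReal.ofReal (diffSymbol (inner ℝ y ξ)) * ‖kh ξ‖ₑ ^ 2) +
      ENNReal.ofReal (2 * (2 * β⁻¹ + (β⁻¹) ^ 2) ^ 2) *
        (ENNReal.ofReal (min 1 δ ^ 2) * ∫⁻ ξ, ‖kh ξ‖ₑ ^ 2) := by
  rw [← hu.lintegral_diff_sq, ← hh.lintegral_diff_sq, ← eLpNorm_two_sq_eq_lintegral kh,
    ← hh.eLpNorm_eq, eLpNorm_two_sq_eq_lintegral]
  have hm : AEMeasurable fun x => ‖h (x + y) - h x‖ₑ ^ 2 :=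
    (((hh.comp_add_right y).1.1).sub hh.1.1).enorm.pow_const 2
  rw [← lintegral_const_mul' _ _ ENNReal.ofReal_ne_top,
    ← lintegral_const_mul' _ _ ENNReal.ofReal_ne_top,
    ← lintegral_const_mul' _ _ ENNReal.ofReal_ne_top, ← lintegral_add_left' (hm.const_mul _)]
  refine lintegral_mono fun x => ?_
  have hB : 0 < β⁻¹ := inv_pos.2 hβ
  simp only [enorm_sq_eq_ofReal]
  rw [← ENNReal.ofReal_mul (by positivity), ← ENNReal.ofReal_mul (by positivity),
    ← ENNReal.ofReal_mul (by positivity), ← ENNReal.ofReal_add (by positivity) (by positivity)]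
  refine ENNReal.ofReal_le_ofReal ?_
  have hp := norm_sub_le_of_reciprocal (u₀ := u x) (u₁ := u (x + y)) hβ (hG x) (hG (x + y)) (hδ x)
  rw [hu_eq, hu_eq] at hp
  refine (pow_le_pow_left₀ (norm_nonneg _) hp 2).trans ?_
  refine (add_sq_le).trans (le_of_eq ?_)
  ring

theorem lintegral_add_add_add {α : Type*} [MeasurableSpace α] {μ : Measure α}
    {f₁ f₂ f₃ : α → ℝ≥0∞} (h₁ : AEMeasurable f₁ μ) (h₂ : AEMeasurable f₂ μ)
    (h₃ : AEMeasurable f₃ μ) (f₄ : α → ℝ≥0∞) :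
    (∫⁻ x, f₁ x ∂μ) + (∫⁻ x, f₂ x ∂μ) + (∫⁻ x, f₃ x ∂μ) + ∫⁻ x, f₄ x ∂μ =
      ∫⁻ x, f₁ x + f₂ x + f₃ x + f₄ x ∂μ := by
  rw [← lintegral_add_left' h₁]
  refine (congrArg (· + _) (lintegral_add_left' (h₁.add h₂) f₃).symm).trans ?_
  exact (lintegral_add_left' ((h₁.add h₂).add h₃) f₄).symm

/-- The constant γ is kept apart from `g` because g + γ need not be in L²; it cancels in every
difference. -/
theorem lintegral_diffSymbol_sq_le_of_reciprocal {β δ : ℝ} {M : ℝ≥0} {h u : Plane → ℂ}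
    {g : Plane → ℝ} {γ : ℝ} {kh kg ku : Plane → ℂ} {y : Plane}
    (hβ : 0 < β) (hh : L2FourierPair h kh) (hg : L2FourierPair (fun x => (g x : ℂ)) kg)
    (hu : L2FourierPair u ku)
    (hG : ∀ x, β ≤ g x + γ) (hu_eq : ∀ x, ((g x + γ : ℝ) : ℂ) * u x = h x)
    (hδ : ∀ x, |g (x + y) - g x| ≤ δ) (hM : ∀ᵐ x, ‖h x‖ ≤ M) :
    ∫⁻ ξ, ENNReal.ofReal (diffSymbol (inner ℝ y ξ) ^ 2) * ‖ku ξ‖ₑ ^ 2 ≤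
      ENNReal.ofReal (4 * (β⁻¹) ^ 2) *
        ((∫⁻ ξ, ENNReal.ofReal (diffSymbol (inner ℝ y ξ) ^ 2) * ‖kh ξ‖ₑ ^ 2) +
        ENNReal.ofReal ((β⁻¹ * M) ^ 2) *
          (∫⁻ ξ, ENNReal.ofReal (diffSymbol (inner ℝ y ξ) ^ 2) * ‖kg ξ‖ₑ ^ 2) +
        ENNReal.ofReal (δ ^ 2) *
          (∫⁻ ξ, ENNReal.ofReal (diffSymbol (inner ℝ y ξ)) * ‖ku ξ‖ₑ ^ 2) +
        ENNReal.ofReal (δ ^ 2) *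
          ∫⁻ ξ, ENNReal.ofReal (diffSymbol (inner ℝ y ξ)) * ‖ku ξ‖ₑ ^ 2) := by
  -- The symbol is even, so the backward difference of u has the same L² norm as the forward one.
  have hneg : ∫⁻ ξ, ENNReal.ofReal (diffSymbol (inner ℝ y ξ)) * ‖ku ξ‖ₑ ^ 2 =
      ∫⁻ x, ‖u (x - y) - u x‖ₑ ^ 2 := by
    simp only [sub_eq_add_neg _ y]
    rw [hu.lintegral_diff_sq (-y)]
    simp only [inner_neg_left, diffSymbol_neg]
  nth_rw 2 [hneg]
  rw [← hu.lintegral_second_diff_sq, ← hh.lintegral_second_diff_sq,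
    ← hg.lintegral_second_diff_sq, ← hu.lintegral_diff_sq]
  have tm : ∀ {f k : Plane → ℂ}, L2FourierPair f k → ∀ y,
      AEStronglyMeasurable fun x => f (x - y) := by
    intro f k hf y
    simpa only [sub_eq_add_neg] using (hf.comp_add_right (-y)).1.1
  have m1 : AEMeasurable fun x => ‖h (x + y) - 2 * h x + h (x - y)‖ₑ ^ 2 :=
    ((((hh.comp_add_right y).1.1).sub (hh.1.1.const_mul 2)).add (tm hh y)).enorm.pow_const 2
  have m2 : AEMeasurable fun x => ‖(g (x + y) : ℂ) - 2 * g x + g (x - y)‖ₑ ^ 2 :=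
    ((((hg.comp_add_right y).1.1).sub (hg.1.1.const_mul 2)).add (tm hg y)).enorm.pow_const 2
  have m3 : AEMeasurable fun x => ‖u (x + y) - u x‖ₑ ^ 2 :=
    (((hu.comp_add_right y).1.1).sub hu.1.1).enorm.pow_const 2
  rw [← lintegral_const_mul' _ _ ENNReal.ofReal_ne_top,
    ← lintegral_const_mul' _ _ ENNReal.ofReal_ne_top,
    ← lintegral_const_mul' _ _ ENNReal.ofReal_ne_top]
  have e4 := lintegral_add_add_add m1 (m2.const_mul (ENNReal.ofReal ((β⁻¹ * M) ^ 2)))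
    (m3.const_mul (ENNReal.ofReal (δ ^ 2)))
    fun x => ENNReal.ofReal (δ ^ 2) * ‖u (x - y) - u x‖ₑ ^ 2
  beta_reduce at e4
  rw [e4, ← lintegral_const_mul' _ _ ENNReal.ofReal_ne_top]
  refine lintegral_mono_ae ?_
  filter_upwards [hM] with x hx
  have hB : 0 < β⁻¹ := inv_pos.2 hβ
  simp only [enorm_sq_eq_ofReal]
  rw [← ENNReal.ofReal_mul (by positivity), ← ENNReal.ofReal_mul (by positivity),
    ← ENNReal.ofReal_mul (by positivity), ← ENNReal.ofReal_add (by positivity) (by positivity),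
    ← ENNReal.ofReal_add (by positivity) (by positivity),
    ← ENNReal.ofReal_add (by positivity) (by positivity), ← ENNReal.ofReal_mul (by positivity)]
  refine ENNReal.ofReal_le_ofReal ?_
  have hd2 : |(g (x - y) + γ) - (g x + γ)| ≤ δ := by
    have := hδ (x - y)
    rw [sub_add_cancel, abs_sub_comm] at this
    simpa using this
  have hp := norm_second_diff_le_of_reciprocal (u₀ := u x) (u₁ := u (x + y)) (u₂ := u (x - y))
    (G₁ := g (x + y) + γ) (δ := δ) (M := M) hβ (hG x) (by simpa using hδ x) hd2
    (by rw [hu_eq]; exact hx)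
  rw [hu_eq, hu_eq, hu_eq, show g (x + y) + γ - 2 * (g x + γ) + (g (x - y) + γ) =
    g (x + y) - 2 * g x + g (x - y) by ring] at hp
  have eg : ‖(g (x + y) : ℂ) - 2 * g x + g (x - y)‖ = |g (x + y) - 2 * g x + g (x - y)| := by
    rw [← Real.norm_eq_abs, ← Complex.norm_real]
    push_cast
    rfl
  rw [eg]
  refine (pow_le_pow_left₀ (norm_nonneg _) hp 2).trans ?_
  have key : ∀ p c q r s : ℝ, (p + c * q + δ * r + δ * s) ^ 2 ≤
      4 * (p ^ 2 + c ^ 2 * q ^ 2 + δ ^ 2 * r ^ 2 + δ ^ 2 * s ^ 2) := by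
    intro p c q r s
    nlinarith [sq_nonneg (p - c * q), sq_nonneg (p - δ * r), sq_nonneg (p - δ * s),
      sq_nonneg (c * q - δ * r), sq_nonneg (c * q - δ * s), sq_nonneg (δ * r - δ * s)]
  rw [mul_pow]
  refine (mul_le_mul_of_nonneg_left (key _ _ _ _ _) (sq_nonneg _)).trans (le_of_eq ?_)
  ring

/-! ### Integration over the step length -/

theorem setLIntegral_Ioi_comp_mul_left {F : ℝ → ℝ≥0∞} (hF : Measurable F) {a : ℝ} (ha : 0 < a) :
    ∫⁻ t in Ioi 0, F (a * t) = ENNReal.ofReal a⁻¹ * ∫⁻ t in Ioi 0, F t := by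
  rw [← lintegral_indicator measurableSet_Ioi, ← lintegral_indicator measurableSet_Ioi]
  have h : ∫⁻ t, (Ioi 0).indicator F (a * t) =
      ENNReal.ofReal a⁻¹ * ∫⁻ t, (Ioi 0).indicator F t := by
    rw [← lintegral_map (hF.indicator measurableSet_Ioi) (measurable_const_mul a),
      Real.map_volume_mul_left ha.ne', lintegral_smul_measure, abs_of_pos (inv_pos.2 ha),
      smul_eq_mul]
  rw [← h]
  refine lintegral_congr fun t => ?_
  by_cases ht : 0 < t
  · rw [indicator_of_mem (mem_Ioi.2 ht), indicator_of_mem (mem_Ioi.2 (mul_pos ha ht))]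
  · rw [indicator_of_notMem (by simpa using ht), indicator_of_notMem]
    simp only [mem_Ioi, not_lt] at ht ⊢
    exact mul_nonpos_of_nonneg_of_nonpos ha.le ht

/-- The Mellin-type integral `∫₀^∞ ψ(t) t^(-p) dt`. -/
def dilationIntegral (ψ : ℝ → ℝ) (p : ℝ) : ℝ≥0∞ :=
  ∫⁻ t in Ioi 0, ENNReal.ofReal (t ^ (-p)) * ENNReal.ofReal (ψ t)

theorem setLIntegral_rpow_mul_comp_mul {ψ : ℝ → ℝ} (hψ : Continuous ψ) (h0 : ψ 0 = 0) {p a : ℝ}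
    (hp : 1 < p) (ha : 0 ≤ a) :
    ∫⁻ t in Ioi 0, ENNReal.ofReal (t ^ (-p)) * ENNReal.ofReal (ψ (a * t)) =
      ENNReal.ofReal (a ^ (p - 1)) * dilationIntegral ψ p := by
  rcases ha.eq_or_lt with rfl | ha
  · simp [h0, Real.zero_rpow (by linarith : p - 1 ≠ 0)]
  have hm : Measurable fun t : ℝ => ENNReal.ofReal (t ^ (-p)) * ENNReal.ofReal (ψ t) :=
    (measurable_id.pow_const _).ennreal_ofReal.mul hψ.measurable.ennreal_ofReal
  have h := setLIntegral_Ioi_comp_mul_left hm ha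
  rw [dilationIntegral, show p - 1 = p + -1 by ring, Real.rpow_add ha, Real.rpow_neg_one,
    ENNReal.ofReal_mul (by positivity), mul_assoc, ← h,
    ← lintegral_const_mul' _ _ ENNReal.ofReal_ne_top]
  refine setLIntegral_congr_fun measurableSet_Ioi fun t ht => ?_
  have e : t ^ (-p) = a ^ p * (a * t) ^ (-p) := by
    rw [Real.mul_rpow ha.le (le_of_lt ht), ← mul_assoc, ← Real.rpow_add ha, add_neg_cancel,
      Real.rpow_zero, one_mul]
  rw [e, ENNReal.ofReal_mul (by positivity), mul_assoc]

/-- Near 0 the integrand is at most K t^(2-p), integrable since p < 3; beyond 1 it is at most K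
t^(-p), integrable since p > 1. -/
theorem dilationIntegral_lt_top {ψ : ℝ → ℝ} {K p : ℝ} (h1 : ∀ t, ψ t ≤ K)
    (h2 : ∀ t, ψ t ≤ K * t ^ 2) (hp : 1 < p) (hp' : p < 3) : dilationIntegral ψ p < ∞ := by
  have hsplit : Ioi (0 : ℝ) = Ioc 0 1 ∪ Ioi 1 := (Ioc_union_Ioi_eq_Ioi zero_le_one).symm
  rw [dilationIntegral, hsplit]
  refine (lintegral_union_le _ _ _).trans_lt (ENNReal.add_lt_top.2 ⟨?_, ?_⟩)
  · have hi : IntegrableOn (fun t : ℝ => t ^ (2 - p)) (Ioc 0 1) :=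
      (intervalIntegrable_iff_integrableOn_Ioc_of_le zero_le_one).1
        (intervalIntegral.intervalIntegrable_rpow' (by linarith))
    refine lt_of_le_of_lt (setLIntegral_mono' measurableSet_Ioc fun t ht => ?_)
      (hi.const_mul K).lintegral_lt_top
    rw [← ENNReal.ofReal_mul (Real.rpow_nonneg ht.1.le _)]
    refine ENNReal.ofReal_le_ofReal ?_
    rw [sub_eq_add_neg, Real.rpow_add ht.1]
    have := mul_le_mul_of_nonneg_left (h2 t) (Real.rpow_nonneg ht.1.le (-p))
    refine this.trans (le_of_eq ?_)
    norm_cast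
    ring
  · have hi := integrableOn_Ioi_rpow_of_lt (by linarith : -p < -1) zero_lt_one
    refine lt_of_le_of_lt (setLIntegral_mono' measurableSet_Ioi fun t ht => ?_)
      (hi.const_mul K).lintegral_lt_top
    have ht0 : (0 : ℝ) < t := zero_lt_one.trans ht
    rw [← ENNReal.ofReal_mul (Real.rpow_nonneg ht0.le _)]
    refine ENNReal.ofReal_le_ofReal ?_
    have := mul_le_mul_of_nonneg_left (h1 t) (Real.rpow_nonneg ht0.le (-p))
    linarith

theorem diffSymbol_le_mul_sq (t : ℝ) : diffSymbol t ≤ 40 * t ^ 2 := by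
  refine (diffSymbol_le_sq t).trans ?_
  have : Real.pi ^ 2 ≤ 10 := by nlinarith [Real.pi_gt_three, Real.pi_lt_d2]
  nlinarith [sq_nonneg t]

theorem dilationIntegral_diffSymbol_lt_top {p : ℝ} (hp : 1 < p) (hp' : p < 3) :
    dilationIntegral diffSymbol p < ∞ :=
  dilationIntegral_lt_top (K := 40) (fun t => (diffSymbol_le_four t).trans (by norm_num))
    diffSymbol_le_mul_sq hp hp'

theorem dilationIntegral_min_sq_lt_top {p : ℝ} (hp : 1 < p) (hp' : p < 3) :
    dilationIntegral (fun t => min 1 |t| ^ 2) p < ∞ := by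
  refine dilationIntegral_lt_top (K := 1) (fun t => ?_) (fun t => ?_) hp hp'
  · exact pow_le_one₀ (le_min zero_le_one (abs_nonneg t)) (min_le_left _ _)
  · rw [one_mul, ← sq_abs t]
    exact pow_le_pow_left₀ (le_min zero_le_one (abs_nonneg t)) (min_le_right _ _) 2

/-- One factor of the symbol is traded for 40 t², which lowers the exponent by 2 into the range
already treated. -/
theorem dilationIntegral_diffSymbol_sq_lt_top {p : ℝ} (hp : 3 < p) (hp' : p < 5) :
    dilationIntegral (fun t => diffSymbol t ^ 2) p < ∞ := by
  have h := dilationIntegral_diffSymbol_lt_top (p := p - 2) (by linarith) (by linarith)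
  refine lt_of_le_of_lt ?_ (ENNReal.mul_lt_top (ENNReal.ofReal_lt_top (r := 40)) h)
  rw [dilationIntegral, dilationIntegral, ← lintegral_const_mul' _ _ ENNReal.ofReal_ne_top]
  refine setLIntegral_mono' measurableSet_Ioi fun t (ht : 0 < t) => ?_
  rw [← ENNReal.ofReal_mul (by positivity), ← ENNReal.ofReal_mul (by positivity),
    ← ENNReal.ofReal_mul (by positivity)]
  refine ENNReal.ofReal_le_ofReal ?_
  rw [show -(p - 2) = -p + 2 by ring, Real.rpow_add ht]
  have e : t ^ (2 : ℝ) = t ^ 2 := by norm_cast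
  rw [e, show 40 * (t ^ (-p) * t ^ 2 * diffSymbol t) = t ^ (-p) * (40 * t ^ 2 * diffSymbol t) by
    ring]
  refine mul_le_mul_of_nonneg_left ?_ (by positivity)
  rw [pow_two (diffSymbol t)]
  exact mul_le_mul_of_nonneg_right (diffSymbol_le_mul_sq t) (diffSymbol_nonneg t)

/-- On (1/4, 1/2] the cosine is nonpositive, so the integrand is at least 4 on an interval of length
1/4. The bound serves to drop this factor from the left side of the final estimate without dividing.
-/
theorem one_le_dilationIntegral_diffSymbol_sq {p : ℝ} (hp : 0 ≤ p) :
    1 ≤ dilationIntegral (fun t => diffSymbol t ^ 2) p := by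
  have hsub : Ioc (1 / 4 : ℝ) (1 / 2) ⊆ Ioi 0 := fun t ht => by
    simp only [mem_Ioc, mem_Ioi] at *
    linarith
  refine le_trans ?_ (lintegral_mono_set hsub)
  have hc : ∫⁻ _ in Ioc (1 / 4 : ℝ) (1 / 2), ENNReal.ofReal 4 = 1 := by
    rw [setLIntegral_const, Real.volume_Ioc, ← ENNReal.ofReal_mul (by norm_num)]
    norm_num
  rw [← hc]
  refine setLIntegral_mono' measurableSet_Ioc fun t ht => ?_
  have ht0 : 0 < t := by linarith [ht.1]
  rw [← ENNReal.ofReal_mul (by positivity)]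
  refine ENNReal.ofReal_le_ofReal ?_
  have h1 : 1 ≤ t ^ (-p) :=
    Real.one_le_rpow_of_pos_of_le_one_of_nonpos ht0 (by linarith [ht.2]) (by linarith)
  have h2 : 2 ≤ diffSymbol t := by
    have : Real.cos (2 * Real.pi * t) ≤ 0 :=
      Real.cos_nonpos_of_pi_div_two_le_of_le (by nlinarith [Real.pi_pos, ht.1])
        (by nlinarith [Real.pi_pos, ht.2])
    unfold diffSymbol
    linarith
  have h3 : 4 ≤ diffSymbol t ^ 2 := by nlinarith
  calc (4 : ℝ) ≤ 1 * diffSymbol t ^ 2 := by linarith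
    _ ≤ _ := mul_le_mul_of_nonneg_right h1 (sq_nonneg _)

/-- The Plancherel side of a difference quotient in the `i`-th coordinate direction. -/
def symbolIntegral (ψ : ℝ → ℝ) (i : Fin 2) (k : Plane → ℂ) (t : ℝ) : ℝ≥0∞ :=
  ∫⁻ ξ, ENNReal.ofReal (ψ (t * ξ i)) * ‖k ξ‖ₑ ^ 2

theorem aemeasurable_symbol {ψ : ℝ → ℝ} (hψ : Continuous ψ) (i : Fin 2) {k : Plane → ℂ}
    (hk : AEStronglyMeasurable k) (μ : Measure ℝ) :
    AEMeasurable (fun p : ℝ × Plane => ENNReal.ofReal (ψ (p.1 * p.2 i)) * ‖k p.2‖ₑ ^ 2)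
      (μ.prod volume) := by
  refine AEMeasurable.mul ?_ ((hk.enorm.pow_const 2).comp_snd)
  exact (hψ.comp (by fun_prop)).measurable.ennreal_ofReal.aemeasurable

theorem aemeasurable_symbolIntegral {ψ : ℝ → ℝ} (hψ : Continuous ψ) (i : Fin 2) {k : Plane → ℂ}
    (hk : AEStronglyMeasurable k) (μ : Measure ℝ) [SFinite μ] :
    AEMeasurable (symbolIntegral ψ i k) μ :=
  (aemeasurable_symbol hψ i hk μ).lintegral_prod_right'

/-- Tonelli, then the substitution t ↦ t/|ξ_i| for each frequency: averaging a symbol over all steps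
produces a pure power of |ξ_i|. -/
theorem setLIntegral_rpow_mul_symbolIntegral {ψ : ℝ → ℝ} (hψ : Continuous ψ) (h0 : ψ 0 = 0)
    (heven : ∀ t, ψ |t| = ψ t) {p : ℝ} (hp : 1 < p) (i : Fin 2) {k : Plane → ℂ}
    (hk : AEStronglyMeasurable k) :
    ∫⁻ t in Ioi 0, ENNReal.ofReal (t ^ (-p)) * symbolIntegral ψ i k t =
      dilationIntegral ψ p * ∫⁻ ξ, ENNReal.ofReal (|ξ i| ^ (p - 1)) * ‖k ξ‖ₑ ^ 2 := by
  have hm : AEMeasurable (fun q : ℝ × Plane => ENNReal.ofReal (q.1 ^ (-p)) *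
      (ENNReal.ofReal (ψ (q.1 * q.2 i)) * ‖k q.2‖ₑ ^ 2))
      ((volume.restrict (Ioi 0)).prod volume) :=
    (measurable_fst.pow_const _).ennreal_ofReal.aemeasurable.mul (aemeasurable_symbol hψ i hk _)
  have e1 : ∀ t : ℝ, ENNReal.ofReal (t ^ (-p)) * symbolIntegral ψ i k t =
      ∫⁻ ξ, ENNReal.ofReal (t ^ (-p)) * (ENNReal.ofReal (ψ (t * ξ i)) * ‖k ξ‖ₑ ^ 2) := fun t => by
    rw [symbolIntegral, lintegral_const_mul' _ _ ENNReal.ofReal_ne_top]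
  simp only [e1]
  rw [lintegral_lintegral_swap hm]
  have e2 : ∀ ξ : Plane, ∫⁻ t in Ioi (0 : ℝ), ENNReal.ofReal (t ^ (-p)) *
      (ENNReal.ofReal (ψ (t * ξ i)) * ‖k ξ‖ₑ ^ 2) =
      dilationIntegral ψ p * (ENNReal.ofReal (|ξ i| ^ (p - 1)) * ‖k ξ‖ₑ ^ 2) := fun ξ => by
    simp only [← mul_assoc]
    rw [lintegral_mul_const' _ _ (by finiteness), mul_comm (dilationIntegral ψ p),
      ← setLIntegral_rpow_mul_comp_mul hψ h0 hp (abs_nonneg _)]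
    congr 1
    refine setLIntegral_congr_fun measurableSet_Ioi fun t (ht : 0 < t) => ?_
    have : ψ (|ξ i| * t) = ψ (t * ξ i) := by
      rw [← heven (t * ξ i), abs_mul, abs_of_pos ht, mul_comm]
    simp only [this]
  simp only [e2]
  have hm2 : AEMeasurable fun ξ : Plane => ENNReal.ofReal (|ξ i| ^ (p - 1)) * ‖k ξ‖ₑ ^ 2 := by
    refine AEMeasurable.mul ?_ (hk.enorm.pow_const 2)
    refine (Measurable.pow_const ?_ _).ennreal_ofReal.aemeasurable
    exact (Continuous.abs (by fun_prop)).measurable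
  rw [lintegral_const_mul'' _ hm2]

theorem abs_rpow_le_one_add_norm_sq_rpow {r s : ℝ} (hr : 0 ≤ r) (hrs : r ≤ 2 * s) (i : Fin 2)
    (ξ : Plane) : |ξ i| ^ r ≤ (1 + ‖ξ‖ ^ 2) ^ s := by
  have h1 : |ξ i| ≤ ‖ξ‖ := PiLp.norm_apply_le ξ i
  have h2 : |ξ i| ≤ (1 + ‖ξ‖ ^ 2) ^ (1 / 2 : ℝ) := by
    rw [← Real.sqrt_eq_rpow]
    exact Real.le_sqrt_of_sq_le (by nlinarith [abs_nonneg (ξ i), norm_nonneg ξ])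
  calc |ξ i| ^ r ≤ ((1 + ‖ξ‖ ^ 2) ^ (1 / 2 : ℝ)) ^ r := by gcongr
    _ = (1 + ‖ξ‖ ^ 2) ^ (1 / 2 * r) := by rw [← Real.rpow_mul (by positivity)]
    _ ≤ _ := Real.rpow_le_rpow_of_exponent_le (by nlinarith [sq_nonneg ‖ξ‖]) (by linarith)

theorem lintegral_abs_rpow_le_besselENorm_sq {r s : ℝ} (hr : 0 ≤ r) (hrs : r ≤ 2 * s) (i : Fin 2)
    (k : Plane → ℂ) :
    ∫⁻ ξ, ENNReal.ofReal (|ξ i| ^ r) * ‖k ξ‖ₑ ^ 2 ≤ besselENorm s k ^ 2 := by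
  rw [besselENorm_sq]
  refine lintegral_mono fun ξ => ?_
  gcongr
  exact abs_rpow_le_one_add_norm_sq_rpow hr hrs i ξ

theorem lintegral_enorm_sq_le_besselENorm_sq {s : ℝ} (hs : 0 ≤ s) (k : Plane → ℂ) :
    ∫⁻ ξ, ‖k ξ‖ₑ ^ 2 ≤ besselENorm s k ^ 2 := by
  rw [← eLpNorm_two_sq_eq_lintegral, ← besselENorm_zero]
  exact pow_le_pow_left' (besselENorm_mono hs k) 2

/-! ### The estimate for 1 < s ≤ 2 -/

/-- The data of a quotient `u = h / (g + b)` together with `L²` Fourier transforms, a Lipschitz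
constant `L` of `g` along the coordinate axes and a bound `M` of `h`. -/
structure ReciprocalData (b : ℝ) (L M : ℝ≥0) (h u : Plane → ℂ) (g : Plane → ℝ)
    (kh kg ku : Plane → ℂ) : Prop where
  pair_h : L2FourierPair h kh
  pair_g : L2FourierPair (fun x => (g x : ℂ)) kg
  pair_u : L2FourierPair u ku
  half_le : ∀ x, b / 2 ≤ g x + b
  mul_eq : ∀ x, ((g x + b : ℝ) : ℂ) * u x = h x
  lipschitz : ∀ (i : Fin 2) (x : Plane) (t : ℝ),
    |g (x + t • EuclideanSpace.single i (1 : ℝ)) - g x| ≤ L * |t|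
  bound : ∀ᵐ x, ‖h x‖ ≤ M

/-- The first-difference bound for u is substituted into the second-difference bound with β = b/2
and δ = Lt, leaving only h and g on the right. -/
theorem exists_symbolIntegral_sq_le {b : ℝ} (hb : 0 < b) :
    ∃ C : ℝ≥0, ∀ {L M : ℝ≥0} {h u : Plane → ℂ} {g : Plane → ℝ} {kh kg ku : Plane → ℂ},
      ReciprocalData b L M h u g kh kg ku → ∀ (i : Fin 2) (t : ℝ), 0 < t →
      symbolIntegral (fun t => diffSymbol t ^ 2) i ku t ≤
        C * (symbolIntegral (fun t => diffSymbol t ^ 2) i kh t +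
          M ^ 2 * symbolIntegral (fun t => diffSymbol t ^ 2) i kg t +
          L ^ 2 * (ENNReal.ofReal (t ^ 2) * symbolIntegral diffSymbol i kh t) +
          L ^ 2 * (ENNReal.ofReal (t ^ 2) * (ENNReal.ofReal (min 1 |L * t| ^ 2) *
            ∫⁻ ξ, ‖kh ξ‖ₑ ^ 2))) := by
  set β : ℝ := b / 2 with hβ
  have hβ0 : 0 < β := by positivity
  refine ⟨Real.toNNReal (4 * (β⁻¹) ^ 2) * (1 + Real.toNNReal ((β⁻¹) ^ 2) +
    2 * Real.toNNReal (2 * (β⁻¹) ^ 2) + 2 * Real.toNNReal (2 * (2 * β⁻¹ + (β⁻¹) ^ 2) ^ 2)),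
    fun {L M h u g kh kg ku} D i t ht => ?_⟩
  have hδ : ∀ x, |g (x + t • EuclideanSpace.single i (1 : ℝ)) - g x| ≤ L * t := fun x => by
    simpa only [abs_of_pos ht] using D.lipschitz i x t
  have h2 := lintegral_diffSymbol_sq_le_of_reciprocal hβ0 D.pair_h D.pair_g D.pair_u D.half_le
    D.mul_eq hδ D.bound
  have h1 := lintegral_diffSymbol_le_of_reciprocal (g := fun x => g x + b) hβ0 D.pair_h D.pair_u
    D.half_le D.mul_eq (fun x => by simpa using hδ x)
  have hin : ∀ ξ : Plane, inner ℝ (t • EuclideanSpace.single i (1 : ℝ)) ξ = t * ξ i := fun ξ => by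
    rw [real_inner_smul_left, EuclideanSpace.inner_single_left]
    simp
  simp only [hin] at h1 h2
  have hLt : (0 : ℝ) ≤ L * t := by positivity
  rw [abs_of_nonneg hLt]
  change symbolIntegral (fun t => diffSymbol t ^ 2) i ku t ≤ _ at h2
  refine h2.trans ?_
  change ENNReal.ofReal _ * (symbolIntegral (fun t => diffSymbol t ^ 2) i kh t + _ *
    symbolIntegral (fun t => diffSymbol t ^ 2) i kg t + _ * symbolIntegral diffSymbol i ku t +
    _ * symbolIntegral diffSymbol i ku t) ≤ _
  change symbolIntegral diffSymbol i ku t ≤ _ * symbolIntegral diffSymbol i kh t + _ at h1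
  have eM : ENNReal.ofReal ((β⁻¹ * M) ^ 2) = ENNReal.ofReal ((β⁻¹) ^ 2) * (M : ℝ≥0∞) ^ 2 := by
    rw [mul_pow, ENNReal.ofReal_mul (by positivity), ENNReal.ofReal_pow (NNReal.coe_nonneg M),
      ENNReal.ofReal_coe_nnreal]
  have eL : ENNReal.ofReal ((L * t) ^ 2) = (L : ℝ≥0∞) ^ 2 * ENNReal.ofReal (t ^ 2) := by
    rw [mul_pow, ENNReal.ofReal_mul (by positivity), ENNReal.ofReal_pow (NNReal.coe_nonneg L),
      ENNReal.ofReal_coe_nnreal]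
  rw [eM, eL]
  push_cast
  change ENNReal.ofReal _ * _ ≤ ENNReal.ofReal _ * (1 + ENNReal.ofReal _ + 2 * ENNReal.ofReal _ +
    2 * ENNReal.ofReal _) * _
  generalize symbolIntegral (fun t => diffSymbol t ^ 2) i kh t = X at *
  generalize symbolIntegral (fun t => diffSymbol t ^ 2) i kg t = Y at *
  generalize symbolIntegral diffSymbol i kh t = Z at *
  generalize symbolIntegral diffSymbol i ku t = U at *
  generalize ENNReal.ofReal (min 1 (L * t) ^ 2) * ∫⁻ ξ, ‖kh ξ‖ₑ ^ 2 = W at *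
  generalize ENNReal.ofReal (2 * (β⁻¹) ^ 2) = c₁ at *
  generalize ENNReal.ofReal (2 * (2 * β⁻¹ + (β⁻¹) ^ 2) ^ 2) = c₂ at *
  generalize ENNReal.ofReal ((β⁻¹) ^ 2) = q at *
  generalize (L : ℝ≥0∞) ^ 2 = l at *
  generalize (M : ℝ≥0∞) ^ 2 = m at *
  generalize ENNReal.ofReal (t ^ 2) = τ at *
  rw [mul_assoc (ENNReal.ofReal (4 * (β⁻¹) ^ 2))]
  refine mul_le_mul' le_rfl ?_
  calc X + q * m * Y + l * τ * U + l * τ * U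
      ≤ X + q * m * Y + l * τ * (c₁ * Z + c₂ * W) + l * τ * (c₁ * Z + c₂ * W) := by gcongr
    -- The added terms are the cross terms of the product of constants; with them the right side
    -- factors exactly.
    _ ≤ X + q * m * Y + l * τ * (c₁ * Z + c₂ * W) + l * τ * (c₁ * Z + c₂ * W) +
        ((q + 2 * c₁ + 2 * c₂) * X + (1 + 2 * c₁ + 2 * c₂) * (m * Y) +
          (1 + q + 2 * c₂) * (l * (τ * Z)) + (1 + q + 2 * c₁) * (l * (τ * W))) := le_self_add
    _ = _ := by ring

theorem continuous_min_abs_sq : Continuous fun t : ℝ => min 1 |t| ^ 2 :=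
  (continuous_const.min continuous_abs).pow 2

/-- Integrate against t^(-1-2s). The second-difference terms need 3 < 1 + 2s < 5; the terms carrying
t² have exponent 2s - 1, which must lie in (1, 3). Both conditions say 1 < s < 2. -/
theorem exists_lintegral_abs_rpow_le_of_lt_two {b s : ℝ} (hb : 0 < b) (hs : 1 < s) (hs' : s < 2) :
    ∃ C : ℝ≥0, ∀ {L M : ℝ≥0} {h u : Plane → ℂ} {g : Plane → ℝ} {kh kg ku : Plane → ℂ},
      ReciprocalData b L M h u g kh kg ku → ∀ i : Fin 2,
      ∫⁻ ξ, ENNReal.ofReal (|ξ i| ^ (2 * s)) * ‖ku ξ‖ₑ ^ 2 ≤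
        C * (besselENorm s kh ^ 2 + M ^ 2 * besselENorm s kg ^ 2 +
          L ^ 2 * besselENorm s kh ^ 2 + (L : ℝ≥0∞) ^ (2 * s) * besselENorm s kh ^ 2) := by
  obtain ⟨C, hC⟩ := exists_symbolIntegral_sq_le hb
  set I₂ := dilationIntegral (fun t => diffSymbol t ^ 2) (1 + 2 * s)
  set I₁ := dilationIntegral diffSymbol (2 * s - 1)
  set I₀ := dilationIntegral (fun t => min 1 |t| ^ 2) (2 * s - 1)
  have hI₂ : I₂ < ∞ := dilationIntegral_diffSymbol_sq_lt_top (by linarith) (by linarith)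
  have hI₁ : I₁ < ∞ := dilationIntegral_diffSymbol_lt_top (by linarith) (by linarith)
  have hI₀ : I₀ < ∞ := dilationIntegral_min_sq_lt_top (by linarith) (by linarith)
  have hI₂' : 1 ≤ I₂ := one_le_dilationIntegral_diffSymbol_sq (by linarith)
  refine ⟨C * (I₂ + I₁ + I₀).toNNReal, fun {L M h u g kh kg ku} D i => ?_⟩
  rw [ENNReal.coe_mul, ENNReal.coe_toNNReal (by finiteness), mul_assoc]
  have hc2 : Continuous fun t => diffSymbol t ^ 2 := continuous_diffSymbol.pow 2
  have z1 : diffSymbol 0 = 0 := by simp [diffSymbol]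
  have z2 : diffSymbol 0 ^ 2 = 0 := by simp [z1]
  have J2 : ∀ {k : Plane → ℂ}, AEStronglyMeasurable k →
      ∫⁻ t in Ioi 0, ENNReal.ofReal (t ^ (-(1 + 2 * s))) *
        symbolIntegral (fun t => diffSymbol t ^ 2) i k t =
        I₂ * ∫⁻ ξ, ENNReal.ofReal (|ξ i| ^ (2 * s)) * ‖k ξ‖ₑ ^ 2 := fun {k} hk => by
    rw [setLIntegral_rpow_mul_symbolIntegral hc2 z2 (fun t => by rw [diffSymbol_abs])
      (by linarith) i hk, add_sub_cancel_left]
  have J1 : ∫⁻ t in Ioi 0, ENNReal.ofReal (t ^ (-(2 * s - 1))) *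
        symbolIntegral diffSymbol i kh t ≤ I₁ * besselENorm s kh ^ 2 := by
    rw [setLIntegral_rpow_mul_symbolIntegral continuous_diffSymbol z1 diffSymbol_abs
      (by linarith) i D.pair_h.2.1]
    gcongr
    exact lintegral_abs_rpow_le_besselENorm_sq (by linarith) (by linarith) i kh
  -- Rescaling by L gives L^(2s-2), which joins the prefactor L² to make L^(2s).
  have J0 : ∫⁻ t in Ioi 0, ENNReal.ofReal (t ^ (-(2 * s - 1))) *
      (ENNReal.ofReal (min 1 |L * t| ^ 2) * ∫⁻ ξ, ‖kh ξ‖ₑ ^ 2) ≤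
      (L : ℝ≥0∞) ^ (2 * s - 2) * I₀ * besselENorm s kh ^ 2 := by
    simp only [← mul_assoc]
    have e := setLIntegral_rpow_mul_comp_mul continuous_min_abs_sq (by simp)
      (p := 2 * s - 1) (by linarith) (NNReal.coe_nonneg L)
    rw [lintegral_mul_const _ (by fun_prop), e,
      ← ENNReal.ofReal_rpow_of_nonneg (NNReal.coe_nonneg L) (by linarith)]
    refine mul_le_mul' (le_of_eq ?_) (lintegral_enorm_sq_le_besselENorm_sq (by linarith) kh)
    rw [show 2 * s - 1 - 1 = 2 * s - 2 by ring]
    congr 2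
    exact ENNReal.ofReal_coe_nnreal
  have hw : Measurable fun t : ℝ => ENNReal.ofReal (t ^ (-(1 + 2 * s))) :=
    (measurable_id.pow_const _).ennreal_ofReal
  have hw1 : Measurable fun t : ℝ => ENNReal.ofReal (t ^ (-(2 * s - 1))) :=
    (measurable_id.pow_const _).ennreal_ofReal
  calc _ ≤ I₂ * ∫⁻ ξ, ENNReal.ofReal (|ξ i| ^ (2 * s)) * ‖ku ξ‖ₑ ^ 2 :=
        le_mul_of_one_le_left' hI₂'
    _ = ∫⁻ t in Ioi 0, ENNReal.ofReal (t ^ (-(1 + 2 * s))) *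
        symbolIntegral (fun t => diffSymbol t ^ 2) i ku t := (J2 D.pair_u.2.1).symm
    _ ≤ ∫⁻ t in Ioi 0, C * (ENNReal.ofReal (t ^ (-(1 + 2 * s))) *
          symbolIntegral (fun t => diffSymbol t ^ 2) i kh t +
        M ^ 2 * (ENNReal.ofReal (t ^ (-(1 + 2 * s))) *
          symbolIntegral (fun t => diffSymbol t ^ 2) i kg t) +
        L ^ 2 * (ENNReal.ofReal (t ^ (-(2 * s - 1))) * symbolIntegral diffSymbol i kh t) +
        L ^ 2 * (ENNReal.ofReal (t ^ (-(2 * s - 1))) * (ENNReal.ofReal (min 1 |L * t| ^ 2) *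
          ∫⁻ ξ, ‖kh ξ‖ₑ ^ 2))) := by
        refine setLIntegral_mono' measurableSet_Ioi fun t (ht : 0 < t) => ?_
        have e : ENNReal.ofReal (t ^ (-(2 * s - 1))) =
            ENNReal.ofReal (t ^ (-(1 + 2 * s))) * ENNReal.ofReal (t ^ 2) := by
          rw [← ENNReal.ofReal_mul (by positivity), show -(2 * s - 1) = -(1 + 2 * s) + (2 : ℕ) by
            push_cast; ring, Real.rpow_add ht, Real.rpow_natCast]
        rw [e]
        refine (mul_le_mul_right (hC D i t ht) _).trans (le_of_eq ?_)
        ring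
    _ = C * (I₂ * (∫⁻ ξ, ENNReal.ofReal (|ξ i| ^ (2 * s)) * ‖kh ξ‖ₑ ^ 2) +
        M ^ 2 * (I₂ * ∫⁻ ξ, ENNReal.ofReal (|ξ i| ^ (2 * s)) * ‖kg ξ‖ₑ ^ 2) +
        L ^ 2 * (∫⁻ t in Ioi 0, ENNReal.ofReal (t ^ (-(2 * s - 1))) *
          symbolIntegral diffSymbol i kh t) +
        L ^ 2 * ∫⁻ t in Ioi 0, ENNReal.ofReal (t ^ (-(2 * s - 1))) *
          (ENNReal.ofReal (min 1 |L * t| ^ 2) * ∫⁻ ξ, ‖kh ξ‖ₑ ^ 2)) := by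
        have m1 := hw.aemeasurable.mul (aemeasurable_symbolIntegral hc2 i D.pair_h.2.1
          (volume.restrict (Ioi 0)))
        have m2 := hw.aemeasurable.mul (aemeasurable_symbolIntegral hc2 i D.pair_g.2.1
          (volume.restrict (Ioi 0)))
        have m3 := hw1.aemeasurable.mul (aemeasurable_symbolIntegral continuous_diffSymbol i
          D.pair_h.2.1 (volume.restrict (Ioi 0)))
        rw [lintegral_const_mul' _ _ ENNReal.coe_ne_top, ← J2 D.pair_h.2.1, ← J2 D.pair_g.2.1,
          ← lintegral_const_mul' ((M : ℝ≥0∞) ^ 2) _ (by finiteness),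
          ← lintegral_const_mul' ((L : ℝ≥0∞) ^ 2) _ (by finiteness),
          ← lintegral_const_mul' ((L : ℝ≥0∞) ^ 2) _ (by finiteness)]
        congr 1
        exact (lintegral_add_add_add m1 (m2.const_mul _) (m3.const_mul _) _).symm
    _ ≤ C * (I₂ * besselENorm s kh ^ 2 + M ^ 2 * (I₂ * besselENorm s kg ^ 2) +
        L ^ 2 * (I₁ * besselENorm s kh ^ 2) +
        L ^ 2 * ((L : ℝ≥0∞) ^ (2 * s - 2) * I₀ * besselENorm s kh ^ 2)) := by
        gcongr
        · exact lintegral_abs_rpow_le_besselENorm_sq (by linarith) le_rfl i kh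
        · exact lintegral_abs_rpow_le_besselENorm_sq (by linarith) le_rfl i kg
    _ ≤ _ := by
        gcongr
        have eL : (L : ℝ≥0∞) ^ (2 * s) = L ^ 2 * (L : ℝ≥0∞) ^ (2 * s - 2) := by
          rw [← ENNReal.rpow_natCast, ← ENNReal.rpow_add_of_nonneg _ _ (by norm_num) (by linarith)]
          congr 1
          push_cast
          ring
        rw [eL]
        generalize besselENorm s kh ^ 2 = X
        generalize besselENorm s kg ^ 2 = Y
        generalize (L : ℝ≥0∞) ^ 2 = l
        generalize (M : ℝ≥0∞) ^ 2 = m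
        generalize (L : ℝ≥0∞) ^ (2 * s - 2) = r
        calc _ ≤ I₂ * X + m * (I₂ * Y) + l * (I₁ * X) + l * (r * I₀ * X) +
              ((I₁ + I₀) * (X + m * Y) + (I₂ + I₀) * (l * X) + (I₂ + I₁) * (l * r * X)) :=
              le_self_add
          _ = _ := by ring

/-- The quadratic upper bound for the cosine on [-π, π] even gives 16 θ². -/
theorem sq_le_diffSymbol {θ : ℝ} (h : |θ| ≤ 1 / 2) : θ ^ 2 ≤ diffSymbol θ := by
  have hx : |2 * Real.pi * θ| ≤ Real.pi := by
    rw [abs_mul, abs_of_pos (by positivity)]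
    nlinarith [Real.pi_pos]
  have hc := Real.cos_le_one_sub_mul_cos_sq hx
  have e : 2 / Real.pi ^ 2 * (2 * Real.pi * θ) ^ 2 = 8 * θ ^ 2 := by
    field_simp
    ring
  unfold diffSymbol
  nlinarith [sq_nonneg θ]

theorem coord_sq_le (i : Fin 2) (ξ : Plane) : ξ i ^ 2 ≤ 1 + ‖ξ‖ ^ 2 := by
  have h1 : |ξ i| ≤ ‖ξ‖ := PiLp.norm_apply_le ξ i
  rw [← sq_abs]
  nlinarith [abs_nonneg (ξ i), norm_nonneg ξ]

theorem symbolIntegral_diffSymbol_sq_le (i : Fin 2) (k : Plane → ℂ) (t : ℝ) :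
    symbolIntegral (fun t => diffSymbol t ^ 2) i k t ≤
      ENNReal.ofReal (t ^ 4) * (1600 * besselENorm 2 k ^ 2) := by
  rw [besselENorm_sq, ← mul_assoc, ← lintegral_const_mul' _ _ (by finiteness), symbolIntegral]
  refine lintegral_mono fun ξ => ?_
  rw [← mul_assoc]
  gcongr
  rw [show (1600 : ℝ≥0∞) = ENNReal.ofReal 1600 by norm_num, ← ENNReal.ofReal_mul (by positivity),
    ← ENNReal.ofReal_mul (by positivity)]
  refine ENNReal.ofReal_le_ofReal ?_
  rw [Real.rpow_ofNat]
  have h1 := diffSymbol_le_mul_sq (t * ξ i)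
  have h2 := coord_sq_le i ξ
  calc diffSymbol (t * ξ i) ^ 2 ≤ (40 * (t * ξ i) ^ 2) ^ 2 :=
        pow_le_pow_left₀ (diffSymbol_nonneg _) h1 2
    _ = t ^ 4 * 1600 * (ξ i ^ 2) ^ 2 := by ring
    _ ≤ _ := by gcongr

theorem symbolIntegral_diffSymbol_le (i : Fin 2) (k : Plane → ℂ) (t : ℝ) :
    symbolIntegral diffSymbol i k t ≤ ENNReal.ofReal (t ^ 2) * (40 * besselENorm 2 k ^ 2) := by
  rw [besselENorm_sq, ← mul_assoc, ← lintegral_const_mul' _ _ (by finiteness), symbolIntegral]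
  refine lintegral_mono fun ξ => ?_
  rw [← mul_assoc]
  gcongr
  rw [show (40 : ℝ≥0∞) = ENNReal.ofReal 40 by norm_num, ← ENNReal.ofReal_mul (by positivity),
    ← ENNReal.ofReal_mul (by positivity)]
  refine ENNReal.ofReal_le_ofReal ?_
  rw [Real.rpow_ofNat]
  have h1 := diffSymbol_le_mul_sq (t * ξ i)
  have h2 := coord_sq_le i ξ
  have h3 : ξ i ^ 2 ≤ (1 + ‖ξ‖ ^ 2) ^ 2 := by nlinarith [sq_nonneg ‖ξ‖]
  calc diffSymbol (t * ξ i) ≤ 40 * (t * ξ i) ^ 2 := h1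
    _ = t ^ 2 * 40 * ξ i ^ 2 := by ring
    _ ≤ _ := by gcongr

/-- Take t = 1/(n+1). Once n ≥ 2|ξ_i| the rescaled squared symbol dominates ξ_i⁴, and Fatou's lemma
passes the bound to the limit. -/
theorem lintegral_coord_pow_four_le {k : Plane → ℂ} (hk : AEStronglyMeasurable k) (i : Fin 2)
    {K : ℝ≥0∞} (h : ∀ t : ℝ, 0 < t →
      symbolIntegral (fun t => diffSymbol t ^ 2) i k t ≤ ENNReal.ofReal (t ^ 4) * K) :
    ∫⁻ ξ, ENNReal.ofReal (ξ i ^ 4) * ‖k ξ‖ₑ ^ 2 ≤ K := by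
  set f : ℕ → Plane → ℝ≥0∞ := fun n ξ => ENNReal.ofReal (((n : ℝ) + 1) ^ 4) *
    (ENNReal.ofReal (diffSymbol (((n : ℝ) + 1)⁻¹ * ξ i) ^ 2) * ‖k ξ‖ₑ ^ 2) with hf
  have hfm : ∀ n, AEMeasurable (f n) := fun n => by
    refine ((Measurable.aemeasurable ?_).mul (hk.enorm.pow_const 2)).const_mul _
    exact ((continuous_diffSymbol.comp (by fun_prop)).pow 2).measurable.ennreal_ofReal
  have hfK : ∀ n, ∫⁻ ξ, f n ξ ≤ K := fun n => by
    have hn : (0 : ℝ) < (n : ℝ) + 1 := by positivity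
    rw [hf, lintegral_const_mul' _ _ ENNReal.ofReal_ne_top]
    refine (mul_le_mul_right (h ((n : ℝ) + 1)⁻¹ (by positivity)) _).trans (le_of_eq ?_)
    rw [← mul_assoc, ← ENNReal.ofReal_mul (by positivity), ← mul_pow, mul_inv_cancel₀ hn.ne']
    simp
  calc _ ≤ ∫⁻ ξ, Filter.liminf (fun n => f n ξ) Filter.atTop := by
        refine lintegral_mono fun ξ => Filter.le_liminf_of_le (by isBoundedDefault) ?_
        filter_upwards [Filter.eventually_ge_atTop ⌈2 * |ξ i|⌉₊] with n hn
        have hn' : 2 * |ξ i| ≤ n := Nat.ceil_le.1 hn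
        have hn0 : (0 : ℝ) < (n : ℝ) + 1 := by positivity
        simp only [hf]
        rw [← mul_assoc, ← ENNReal.ofReal_mul (by positivity)]
        gcongr
        have hs : |((n : ℝ) + 1)⁻¹ * ξ i| ≤ 1 / 2 := by
          rw [abs_mul, abs_of_pos (by positivity), inv_mul_le_iff₀ hn0]
          linarith
        have h1 := pow_le_pow_left₀ (sq_nonneg _) (sq_le_diffSymbol hs) 2
        calc ξ i ^ 4 = ((n : ℝ) + 1) ^ 4 * ((((n : ℝ) + 1)⁻¹ * ξ i) ^ 2) ^ 2 := by
              field_simp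
          _ ≤ _ := by gcongr
    _ ≤ Filter.liminf (fun n => ∫⁻ ξ, f n ξ) Filter.atTop := lintegral_liminf_le' hfm
    _ ≤ K := Filter.liminf_le_of_frequently_le' (Filter.Frequently.of_forall hfK)

/-- Each term on the right of the second-difference estimate is O(t⁴), with min(1, Lt) ≤ Lt in the
last one; the constant 1600 is 40². -/
theorem exists_lintegral_abs_rpow_le_two {b : ℝ} (hb : 0 < b) :
    ∃ C : ℝ≥0, ∀ {L M : ℝ≥0} {h u : Plane → ℂ} {g : Plane → ℝ} {kh kg ku : Plane → ℂ},
      ReciprocalData b L M h u g kh kg ku → ∀ i : Fin 2,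
      ∫⁻ ξ, ENNReal.ofReal (|ξ i| ^ ((2 : ℝ) * 2)) * ‖ku ξ‖ₑ ^ 2 ≤
        C * (besselENorm 2 kh ^ 2 + M ^ 2 * besselENorm 2 kg ^ 2 +
          L ^ 2 * besselENorm 2 kh ^ 2 + (L : ℝ≥0∞) ^ ((2 : ℝ) * 2) * besselENorm 2 kh ^ 2) := by
  obtain ⟨C, hC⟩ := exists_symbolIntegral_sq_le hb
  refine ⟨C * 1600, fun {L M h u g kh kg ku} D i => ?_⟩
  have e4 : ∀ ξ : Plane, |ξ i| ^ ((2 : ℝ) * 2) = ξ i ^ 4 := fun ξ => by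
    rw [show (2 : ℝ) * 2 = ((4 : ℕ) : ℝ) by norm_num, Real.rpow_natCast]
    exact Even.pow_abs (by decide) _
  simp only [e4]
  refine lintegral_coord_pow_four_le D.pair_u.2.1 i fun t ht => (hC D i t ht).trans ?_
  have hτ : ENNReal.ofReal (t ^ 4) = ENNReal.ofReal (t ^ 2) * ENNReal.ofReal (t ^ 2) := by
    rw [← ENNReal.ofReal_mul (by positivity)]
    ring_nf
  have hmin : ENNReal.ofReal (min 1 |L * t| ^ 2) ≤ (L : ℝ≥0∞) ^ 2 * ENNReal.ofReal (t ^ 2) := by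
    have : (L : ℝ≥0∞) ^ 2 * ENNReal.ofReal (t ^ 2) = ENNReal.ofReal ((L * t) ^ 2) := by
      rw [mul_pow, ENNReal.ofReal_mul (by positivity), ENNReal.ofReal_pow (NNReal.coe_nonneg L),
        ENNReal.ofReal_coe_nnreal]
    rw [this]
    refine ENNReal.ofReal_le_ofReal ?_
    rw [← sq_abs (L * t)]
    exact pow_le_pow_left₀ (le_min zero_le_one (abs_nonneg _)) (min_le_right _ _) 2
  have eL : (L : ℝ≥0∞) ^ ((2 : ℝ) * 2) = (L : ℝ≥0∞) ^ 2 * (L : ℝ≥0∞) ^ 2 := by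
    rw [show (2 : ℝ) * 2 = ((4 : ℕ) : ℝ) by norm_num, ENNReal.rpow_natCast]
    ring
  rw [eL]
  push_cast
  have a1 := symbolIntegral_diffSymbol_sq_le i kh t
  have a2 := symbolIntegral_diffSymbol_sq_le i kg t
  have a3 := symbolIntegral_diffSymbol_le i kh t
  have a4 := lintegral_enorm_sq_le_besselENorm_sq (s := 2) (by norm_num) kh
  rw [hτ] at *
  generalize symbolIntegral (fun t => diffSymbol t ^ 2) i kh t = X at *
  generalize symbolIntegral (fun t => diffSymbol t ^ 2) i kg t = Y at *
  generalize symbolIntegral diffSymbol i kh t = Z at *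
  generalize ENNReal.ofReal (min 1 |L * t| ^ 2) = m at *
  generalize ∫⁻ ξ, ‖kh ξ‖ₑ ^ 2 = J at *
  generalize besselENorm 2 kh ^ 2 = A at *
  generalize besselENorm 2 kg ^ 2 = B at *
  generalize ENNReal.ofReal (t ^ 2) = τ at *
  generalize (L : ℝ≥0∞) ^ 2 = l at *
  generalize (M : ℝ≥0∞) ^ 2 = μ at *
  calc (C : ℝ≥0∞) * (X + μ * Y + l * (τ * Z) + l * (τ * (m * J)))
      ≤ C * (τ * τ * (1600 * A) + μ * (τ * τ * (1600 * B)) + l * (τ * (τ * (40 * A))) +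
        l * (τ * (l * τ * A))) := by gcongr
    _ ≤ C * (τ * τ * (1600 * A) + μ * (τ * τ * (1600 * B)) + l * (τ * (τ * (40 * A))) +
        l * (τ * (l * τ * A))) +
        C * (l * (τ * (τ * (1560 * A))) + 1599 * (l * (τ * (l * τ * A)))) :=
        le_self_add
    _ = _ := by ring

theorem exists_lintegral_abs_rpow_le {b s : ℝ} (hb : 0 < b) (hs : 1 < s) (hs' : s ≤ 2) :
    ∃ C : ℝ≥0, ∀ {L M : ℝ≥0} {h u : Plane → ℂ} {g : Plane → ℝ} {kh kg ku : Plane → ℂ},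
      ReciprocalData b L M h u g kh kg ku → ∀ i : Fin 2,
      ∫⁻ ξ, ENNReal.ofReal (|ξ i| ^ (2 * s)) * ‖ku ξ‖ₑ ^ 2 ≤
        C * (besselENorm s kh ^ 2 + M ^ 2 * besselENorm s kg ^ 2 +
          L ^ 2 * besselENorm s kh ^ 2 + (L : ℝ≥0∞) ^ (2 * s) * besselENorm s kh ^ 2) := by
  rcases hs'.lt_or_eq with h | rfl
  · exact exists_lintegral_abs_rpow_le_of_lt_two hb hs h
  · exact exists_lintegral_abs_rpow_le_two hb

theorem one_add_norm_sq_rpow_le {s : ℝ} (hs : 0 ≤ s) (ξ : Plane) :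
    (1 + ‖ξ‖ ^ 2) ^ s ≤ 2 ^ s * 2 ^ s * (1 + |ξ 0| ^ (2 * s) + |ξ 1| ^ (2 * s)) := by
  have e : ∀ x : ℝ, (x ^ 2) ^ s = |x| ^ (2 * s) := fun x => by
    rw [Real.rpow_mul (abs_nonneg x), Real.rpow_two, sq_abs]
  have hn : ‖ξ‖ ^ 2 = ξ 0 ^ 2 + ξ 1 ^ 2 := by
    rw [EuclideanSpace.norm_sq_eq, Fin.sum_univ_two, Real.norm_eq_abs, Real.norm_eq_abs, sq_abs,
      sq_abs]
  have h1 := add_rpow_le_two_rpow_mul zero_le_one (sq_nonneg ‖ξ‖) hs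
  have h2 := add_rpow_le_two_rpow_mul (sq_nonneg (ξ 0)) (sq_nonneg (ξ 1)) hs
  rw [← hn, e (ξ 0), e (ξ 1)] at h2
  rw [Real.one_rpow] at h1
  have h3 : (1 : ℝ) ≤ 2 ^ s := Real.one_le_rpow (by norm_num) hs
  calc _ ≤ 2 ^ s * (1 + (‖ξ‖ ^ 2) ^ s) := h1
    _ ≤ 2 ^ s * (2 ^ s + 2 ^ s * (|ξ 0| ^ (2 * s) + |ξ 1| ^ (2 * s))) := by gcongr
    _ = _ := by ring

theorem besselENorm_sq_le_lintegral_coord {s : ℝ} (hs : 0 ≤ s) {k : Plane → ℂ}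
    (hk : AEStronglyMeasurable k) :
    besselENorm s k ^ 2 ≤ ENNReal.ofReal (2 ^ s * 2 ^ s) * ((∫⁻ ξ, ‖k ξ‖ₑ ^ 2) +
      (∫⁻ ξ, ENNReal.ofReal (|ξ 0| ^ (2 * s)) * ‖k ξ‖ₑ ^ 2) +
      ∫⁻ ξ, ENNReal.ofReal (|ξ 1| ^ (2 * s)) * ‖k ξ‖ₑ ^ 2) := by
  have hm : AEMeasurable fun ξ => ‖k ξ‖ₑ ^ 2 := hk.enorm.pow_const 2
  have hm0 : AEMeasurable fun ξ : Plane => ENNReal.ofReal (|ξ 0| ^ (2 * s)) * ‖k ξ‖ₑ ^ 2 := by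
    refine AEMeasurable.mul (Measurable.aemeasurable ?_) hm
    exact (Measurable.pow_const (Continuous.abs (by fun_prop)).measurable _).ennreal_ofReal
  have e : (∫⁻ ξ, ‖k ξ‖ₑ ^ 2) + (∫⁻ ξ, ENNReal.ofReal (|ξ 0| ^ (2 * s)) * ‖k ξ‖ₑ ^ 2) +
      (∫⁻ ξ, ENNReal.ofReal (|ξ 1| ^ (2 * s)) * ‖k ξ‖ₑ ^ 2) =
      ∫⁻ ξ, ‖k ξ‖ₑ ^ 2 + ENNReal.ofReal (|ξ 0| ^ (2 * s)) * ‖k ξ‖ₑ ^ 2 +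
        ENNReal.ofReal (|ξ 1| ^ (2 * s)) * ‖k ξ‖ₑ ^ 2 := by
    rw [← lintegral_add_left' hm]
    exact (lintegral_add_left' (hm.add hm0) _).symm
  rw [e, besselENorm_sq, ← lintegral_const_mul' _ _ ENNReal.ofReal_ne_top]
  refine lintegral_mono fun ξ => ?_
  refine (mul_le_mul_left (ENNReal.ofReal_le_ofReal (one_add_norm_sq_rpow_le hs ξ)) _).trans
    (le_of_eq ?_)
  rw [ENNReal.ofReal_mul (by positivity), ENNReal.ofReal_add (by positivity) (by positivity),
    ENNReal.ofReal_add (by positivity) (by positivity), ENNReal.ofReal_one]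
  ring

theorem ReciprocalData.lintegral_enorm_sq_le {b : ℝ} (hb : 0 < b) {L M : ℝ≥0} {h u : Plane → ℂ}
    {g : Plane → ℝ} {kh kg ku : Plane → ℂ} (D : ReciprocalData b L M h u g kh kg ku) :
    ∫⁻ ξ, ‖ku ξ‖ₑ ^ 2 ≤ ENNReal.ofReal (2 / b) ^ 2 * ∫⁻ ξ, ‖kh ξ‖ₑ ^ 2 := by
  rw [← eLpNorm_two_sq_eq_lintegral, ← eLpNorm_two_sq_eq_lintegral, ← D.pair_u.eLpNorm_eq,
    ← D.pair_h.eLpNorm_eq, ← mul_pow]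
  refine pow_le_pow_left' (eLpNorm_le_mul_eLpNorm_of_ae_le_mul (.of_forall fun x => ?_) 2) 2
  rw [← D.mul_eq x, norm_mul, Complex.norm_real, Real.norm_eq_abs, ← mul_assoc]
  refine le_mul_of_one_le_left (norm_nonneg _) ?_
  rw [div_mul_eq_mul_div, le_div_iff₀ hb]
  linarith [D.half_le x, le_abs_self (g x + b)]

theorem ennreal_le_one_add_rpow (x : ℝ≥0∞) {s : ℝ} (hs : 1 ≤ s) : x ≤ 1 + x ^ s := by
  rcases le_total x 1 with h | h
  · exact h.trans le_self_add
  · refine le_trans ?_ le_add_self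
    simpa using ENNReal.rpow_le_rpow_of_exponent_le h hs

/-- A crude Young inequality: replace the smaller of the two by the larger. -/
theorem ennreal_mul_rpow_le (x y : ℝ≥0∞) {s : ℝ} (hs : 1 ≤ s) :
    x * y ^ (s - 1) ≤ x ^ s + y ^ s := by
  have e : ∀ z : ℝ≥0∞, z * z ^ (s - 1) = z ^ s := fun z => by
    nth_rw 1 [← ENNReal.rpow_one z]
    rw [← ENNReal.rpow_add_of_nonneg _ _ zero_le_one (by linarith)]
    congr 1
    ring
  rcases le_total x y with h | h
  · calc x * y ^ (s - 1) ≤ y * y ^ (s - 1) := by gcongr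
      _ = y ^ s := e y
      _ ≤ _ := le_add_self
  · calc x * y ^ (s - 1) ≤ x * x ^ (s - 1) :=
          mul_le_mul' le_rfl (ENNReal.rpow_le_rpow h (by linarith))
      _ = x ^ s := e x
      _ ≤ _ := le_self_add

/-- The sup bound M of h is taken to be the L¹ norm of its transform, hence at most C₁‖h‖_s; this
turns M‖g‖_s into a multiple of ‖g‖_s ‖h‖_s. -/
theorem exists_besselENorm_reciprocal_le_of_le_two {b s : ℝ} (hb : 0 < b) (hs : 1 < s)
    (hs' : s ≤ 2) :
    ∃ C : ℝ≥0, ∀ {L : ℝ≥0} {h u : Plane → ℂ} {g : Plane → ℝ} {kh kg ku : Plane → ℂ},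
      ReciprocalData b L (∫⁻ ξ, ‖kh ξ‖ₑ).toNNReal h u g kh kg ku → besselENorm s kh < ∞ →
      besselENorm s ku ≤ C * (1 + (L : ℝ≥0∞) ^ s + besselENorm s kg ^ s) * besselENorm s kh := by
  obtain ⟨C, hC⟩ := exists_lintegral_abs_rpow_le hb hs hs'
  obtain ⟨C₁, hC₁⟩ := exists_lintegral_enorm_le_besselENorm hs
  set c₀ : ℝ≥0 := Real.toNNReal (2 ^ s * 2 ^ s)
  set c₁ : ℝ≥0 := Real.toNNReal (2 / b) ^ 2
  set E : ℝ≥0 := c₀ * (c₁ + 2 * C) * (1 + C₁ ^ 2) * 4 with hE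
  -- The estimate is proved for squares with constant E, and E ≤ (E + 1)² avoids a square root.
  refine ⟨E + 1, fun {L h u g kh kg ku} D hkh => ?_⟩
  have hM : (((∫⁻ ξ, ‖kh ξ‖ₑ).toNNReal : ℝ≥0) : ℝ≥0∞) ≤ C₁ * besselENorm s kh := by
    refine ENNReal.coe_toNNReal_le_self.trans (hC₁ kh D.pair_h.2.1)
  have h0 := hC D 0
  have h1 := hC D 1
  have h2 := (D.lintegral_enorm_sq_le hb).trans
    (mul_le_mul_right (lintegral_enorm_sq_le_besselENorm_sq (by linarith : 0 ≤ s) kh) _)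
  have hN := besselENorm_sq_le_lintegral_coord (by linarith : 0 ≤ s) D.pair_u.2.1
  set X := besselENorm s kh
  set A := besselENorm s kg
  generalize (L : ℝ≥0∞) = l at *
  set S : ℝ≥0∞ := 1 + l ^ s + A ^ s with hS
  have b0 : (1 : ℝ≥0∞) ≤ S ^ 2 := by
    refine one_le_pow₀ ?_
    rw [hS, add_assoc]
    exact le_self_add
  have b1 : l ^ 2 ≤ S ^ 2 :=
    pow_le_pow_left' ((ennreal_le_one_add_rpow l hs.le).trans le_self_add) 2
  have b2 : A ^ 2 ≤ S ^ 2 := by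
    refine pow_le_pow_left' ((ennreal_le_one_add_rpow A hs.le).trans ?_) 2
    rw [hS]
    gcongr
    exact le_self_add
  have b3 : l ^ (2 * s) ≤ S ^ 2 := by
    rw [mul_comm, ENNReal.rpow_mul, ENNReal.rpow_two]
    refine pow_le_pow_left' ?_ 2
    rw [hS]
    exact le_add_self.trans le_self_add
  have hR : X ^ 2 + ((∫⁻ ξ, ‖kh ξ‖ₑ).toNNReal : ℝ≥0∞) ^ 2 * A ^ 2 + l ^ 2 * X ^ 2 +
      l ^ (2 * s) * X ^ 2 ≤ (1 + C₁ ^ 2) * 4 * (S ^ 2 * X ^ 2) := by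
    calc _ ≤ 1 * X ^ 2 + (C₁ * X) ^ 2 * A ^ 2 + l ^ 2 * X ^ 2 + l ^ (2 * s) * X ^ 2 := by
          rw [one_mul]
          gcongr
      _ ≤ S ^ 2 * X ^ 2 + (C₁ * X) ^ 2 * S ^ 2 + S ^ 2 * X ^ 2 + S ^ 2 * X ^ 2 := by gcongr
      _ ≤ S ^ 2 * X ^ 2 + (C₁ * X) ^ 2 * S ^ 2 + S ^ 2 * X ^ 2 + S ^ 2 * X ^ 2 +
          (S ^ 2 * X ^ 2 + 3 * C₁ ^ 2 * (S ^ 2 * X ^ 2)) := le_self_add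
      _ = _ := by ring
  have hX : X ^ 2 ≤ (1 + C₁ ^ 2) * 4 * (S ^ 2 * X ^ 2) :=
    le_trans (by rw [add_assoc, add_assoc]; exact le_self_add) hR
  have hfin : besselENorm s ku ^ 2 ≤ E * (S ^ 2 * X ^ 2) := by
    calc _ ≤ _ := hN
      _ ≤ (c₀ : ℝ≥0∞) * (c₁ * ((1 + C₁ ^ 2) * 4 * (S ^ 2 * X ^ 2)) +
          C * ((1 + C₁ ^ 2) * 4 * (S ^ 2 * X ^ 2)) + C * ((1 + C₁ ^ 2) * 4 * (S ^ 2 * X ^ 2))) := by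
          refine mul_le_mul' le_rfl (add_le_add (add_le_add (h2.trans ?_)
            (h0.trans (mul_le_mul' le_rfl hR))) (h1.trans (mul_le_mul' le_rfl hR)))
          refine mul_le_mul' (le_of_eq ?_) hX
          simp [c₁, ENNReal.ofReal]
      _ = _ := by
          rw [hE]
          push_cast
          ring
  refine (ENNReal.pow_le_pow_left_iff two_ne_zero).1 (hfin.trans ?_)
  rw [mul_pow, mul_pow, ← mul_assoc]
  gcongr
  push_cast
  have : (E : ℝ≥0∞) ≤ (E + 1) * (E + 1) := by
    calc (E : ℝ≥0∞) ≤ E + (E * E + E + 1) := le_self_add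
      _ = _ := by ring
  rw [pow_two]
  exact this

/-! ### Induction on the order of smoothness -/

theorem exists_besselENorm_reciprocal_le {b : ℝ} (hb : 0 < b) (n : ℕ) :
    ∀ s : ℝ, 1 < s → s ≤ n + 2 →
    ∃ C : ℝ≥0, ∀ {L : ℝ≥0} {h u : Plane → ℂ} {g : Plane → ℝ} {kh kg ku : Plane → ℂ},
      ReciprocalData b L (∫⁻ ξ, ‖kh ξ‖ₑ).toNNReal h u g kh kg ku → besselENorm s kh < ∞ →
      besselENorm s kg < ∞ →
      besselENorm s ku ≤ C * (1 + (L : ℝ≥0∞) ^ s + besselENorm s kg ^ s) * besselENorm s kh := by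
  induction n with
  | zero =>
    intro s hs hs'
    obtain ⟨C, hC⟩ := exists_besselENorm_reciprocal_le_of_le_two hb hs (by simpa using hs')
    exact ⟨C, fun D h _ => hC D h⟩
  | succ n ih =>
    intro s hs hs'
    rcases le_or_gt s 2 with h2 | h2
    · obtain ⟨C, hC⟩ := exists_besselENorm_reciprocal_le_of_le_two hb hs h2
      exact ⟨C, fun D h _ => hC D h⟩
    push_cast at hs'
    obtain ⟨C, hC⟩ := ih (s - 1) (by linarith) (by linarith)
    obtain ⟨C', hC'⟩ := exists_besselENorm_reciprocal_step_le h2 hb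
    refine ⟨C' * (1 + 4 * C), fun {L h u g kh kg ku} D hkh hkg => ?_⟩
    have mh := besselENorm_mono (by linarith : s - 1 ≤ s) kh
    have mg := besselENorm_mono (by linarith : s - 1 ≤ s) kg
    have hI := hC D (mh.trans_lt hkh) (mg.trans_lt hkg)
    -- The induction hypothesis also provides the finiteness of ‖u‖_{s-1} that the
    -- derivative-gaining step requires.
    have hfin : besselENorm (s - 1) ku < ∞ := by
      refine hI.trans_lt (ENNReal.mul_lt_top (ENNReal.mul_lt_top ENNReal.coe_lt_top ?_)
        (mh.trans_lt hkh))
      have := ENNReal.rpow_lt_top_of_nonneg (y := s - 1) (by linarith) (mg.trans_lt hkg).ne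
      have := ENNReal.rpow_lt_top_of_nonneg (y := s - 1) (by linarith) (ENNReal.coe_ne_top (r := L))
      finiteness
    have hstep := hC' h u g kh kg ku D.pair_h D.pair_g D.pair_u D.half_le D.mul_eq hkg hfin
    refine hstep.trans ?_
    rw [ENNReal.coe_mul, mul_assoc (C' : ℝ≥0∞), mul_assoc (C' : ℝ≥0∞)]
    refine mul_le_mul' le_rfl ?_
    have hI' : besselENorm (s - 1) ku ≤ C * (1 + (L : ℝ≥0∞) ^ (s - 1) +
        besselENorm s kg ^ (s - 1)) * besselENorm s kh := by
      refine hI.trans ?_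
      have := ENNReal.rpow_le_rpow mg (by linarith : 0 ≤ s - 1)
      gcongr
    have e1 := ennreal_le_one_add_rpow (besselENorm s kg) hs.le
    have e2 := ennreal_mul_rpow_le (besselENorm s kg) L hs.le
    have e3 := ennreal_mul_rpow_le (besselENorm s kg) (besselENorm s kg) hs.le
    generalize besselENorm s kg = A at *
    generalize besselENorm s kh = X at *
    push_cast
    generalize (L : ℝ≥0∞) ^ (s - 1) = p at *
    generalize (L : ℝ≥0∞) ^ s = P at *
    generalize A ^ (s - 1) = q at *
    generalize A ^ s = Q at *
    calc X + A * besselENorm (s - 1) ku ≤ X + A * (C * (1 + p + q) * X) := by gcongr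
      _ = X + C * (A + A * p + A * q) * X := by ring
      _ ≤ X + C * ((1 + Q) + (Q + P) + (Q + Q)) * X := by gcongr
      _ ≤ X + C * ((1 + Q) + (Q + P) + (Q + Q)) * X + ((P + Q) * X + C * (3 + 3 * P) * X) :=
        le_self_add
      _ = _ := by ring

/-! ### From the C¹ norm to a Lipschitz bound, and degenerate cases -/

/-- The essential bound holds on a dense set, and continuity of the partial derivative extends it to
every point. -/
theorem abs_fderiv_le_c1ENorm {g : Plane → ℝ} (hg : ContDiff ℝ 1 g) (hfin : c1ENorm g < ∞)
    (i : Fin 2) (x : Plane) :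
    |fderiv ℝ g x (EuclideanSpace.single i 1)| ≤ (c1ENorm g).toNNReal := by
  have hle : eLpNorm (fun x => fderiv ℝ g x (EuclideanSpace.single i 1)) ∞ volume ≤ c1ENorm g :=
    (Finset.single_le_sum (f := fun i : Fin 2 =>
      eLpNorm (fun x => fderiv ℝ g x (EuclideanSpace.single i 1)) ∞ volume)
      (fun _ _ => zero_le) (Finset.mem_univ i)).trans le_add_self
  have hcont : Continuous fun x => fderiv ℝ g x (EuclideanSpace.single i (1 : ℝ)) :=
    (hg.continuous_fderiv (by norm_num)).clm_apply continuous_const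
  have hae : ∀ᵐ x, |fderiv ℝ g x (EuclideanSpace.single i 1)| ≤ (c1ENorm g).toNNReal := by
    have h := ae_le_eLpNormEssSup (μ := volume)
      (f := fun x => fderiv ℝ g x (EuclideanSpace.single i (1 : ℝ)))
    filter_upwards [h] with y hy
    rw [← eLpNorm_exponent_top] at hy
    have h2 := ENNReal.toReal_mono hfin.ne (hy.trans hle)
    rwa [toReal_enorm, Real.norm_eq_abs] at h2
  have hd := Measure.dense_of_ae hae
  have hcl : IsClosed {x | |fderiv ℝ g x (EuclideanSpace.single i 1)| ≤ (c1ENorm g).toNNReal} :=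
    isClosed_le hcont.abs continuous_const
  have := hd.closure_eq
  rw [hcl.closure_eq] at this
  exact eq_univ_iff_forall.1 this x

theorem abs_sub_le_c1ENorm_mul {g : Plane → ℝ} (hg : ContDiff ℝ 1 g) (hfin : c1ENorm g < ∞)
    (i : Fin 2) (x : Plane) (t : ℝ) :
    |g (x + t • EuclideanSpace.single i (1 : ℝ)) - g x| ≤ (c1ENorm g).toNNReal * |t| := by
  set e : Plane := EuclideanSpace.single i (1 : ℝ)
  have hd : ∀ r ∈ (univ : Set ℝ), HasDerivWithinAt (fun r : ℝ => g (x + r • e))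
      (fderiv ℝ g (x + r • e) e) univ r := fun r _ => by
    have h1 : HasDerivAt (fun r : ℝ => x + r • e) e r := by
      simpa using ((hasDerivAt_id r).smul_const e).const_add x
    exact (((hg.differentiable (by norm_num)) _).hasFDerivAt.comp_hasDerivAt r h1).hasDerivWithinAt
  have h := convex_univ.norm_image_sub_le_of_norm_hasDerivWithin_le hd
    (fun r _ => abs_fderiv_le_c1ENorm hg hfin i _) (mem_univ 0) (mem_univ t)
  simpa using h

theorem l2FourierPair_zero : L2FourierPair (fun _ => 0) (fun _ => 0) :=
  ⟨MemLp.zero, MemLp.zero, fun φ => by simp⟩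

theorem hsENorm_eq_zero_of_ae_eq_zero {s : ℝ} {f : Plane → ℂ} (hf : f =ᵐ[volume] fun _ => 0) :
    hsENorm s f = 0 := by
  have h := l2FourierPair_zero.congr hf.symm (Filter.EventuallyEq.refl _ _)
  have h0 : besselENorm s (fun _ => 0) = 0 := by simp [besselENorm]
  rw [h.hsENorm_eq (by rw [h0]; exact ENNReal.zero_lt_top), h0]

theorem ae_eq_zero_of_besselENorm_eq_zero {s : ℝ} {f k : Plane → ℂ} (h : L2FourierPair f k)
    (hs : 0 ≤ s) (hk : besselENorm s k = 0) : f =ᵐ[volume] fun _ => 0 := by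
  have h2 : eLpNorm f 2 = 0 := by
    have := besselENorm_mono hs k
    rw [hk, besselENorm_zero, ← h.eLpNorm_eq] at this
    exact le_antisymm this zero_le
  exact (eLpNorm_eq_zero_iff h.1.1 (by norm_num)).1 h2

theorem memLp_div_of_half_le {b : ℝ} (hb : 0 < b) {h : Plane → ℂ} {g : Plane → ℝ}
    (hh : MemLp h 2) (hg : Continuous g) (hgb : ∀ x, b / 2 ≤ g x + b) :
    MemLp (fun x => h x / ((g x + b : ℝ) : ℂ)) 2 := by
  have hc : Continuous fun x => ((g x + b : ℝ) : ℂ) :=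
    Complex.continuous_ofReal.comp (hg.add continuous_const)
  refine hh.of_le_mul (c := 2 / b) (hh.1.div₀ hc.aestronglyMeasurable) (.of_forall fun x => ?_)
  have h0 : 0 < g x + b := lt_of_lt_of_le (by positivity) (hgb x)
  rw [norm_div, Complex.norm_of_nonneg h0.le, div_eq_mul_inv, mul_comm]
  gcongr
  rw [show 2 / b = (b / 2)⁻¹ by rw [inv_div]]
  exact inv_anti₀ (by positivity) (hgb x)

end

theorem mainTheorem7 (s b : ℝ) (hs : 1 < s) (hb : 0 < b) :
    ∃ C : ℝ≥0, ∀ (h : Plane → ℂ) (g : Plane → ℝ),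
      MemHs s h →
      MemHs s (fun x => (g x : ℂ)) →
      ContDiff ℝ 1 g →
      (∀ x, g x + b > (1 / 2) * b) →
      hsENorm s (fun x => h x / ((g x + b : ℝ) : ℂ)) ≤
        (C : ℝ≥0∞) * (1 + c1ENorm g ^ s + hsENorm s (fun x => (g x : ℂ)) ^ s) *
          hsENorm s h := by
  obtain ⟨C, hC⟩ := exists_besselENorm_reciprocal_le hb ⌈s⌉₊ s hs
    ((Nat.le_ceil s).trans (by linarith))
  -- Adding 1 makes the constant nonzero, so that the right side is really ∞ when ‖g‖_{C¹} = ∞ and h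
  -- does not vanish.
  refine ⟨C + 1, fun h g hh hg hg1 hgb => ?_⟩
  have hs0 : 0 ≤ s := by linarith
  obtain ⟨kh, ph, nh⟩ := hh.exists_fourierPair hs0
  obtain ⟨kg, pg, ng⟩ := hg.exists_fourierPair hs0
  have hgb' : ∀ x, b / 2 ≤ g x + b := fun x => by linarith [hgb x]
  obtain ⟨ku, pu⟩ := L2FourierPair.exists_right (memLp_div_of_half_le hb ph.1 hg1.continuous hgb')
  rw [ph.hsENorm_eq nh, pg.hsENorm_eq ng]
  -- With the convention ∞ · 0 = 0 this case needs its own argument: h, and hence the quotient,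
  -- vanishes almost everywhere.
  rcases eq_or_ne (besselENorm s kh) 0 with h0 | h0
  · have hz := ae_eq_zero_of_besselENorm_eq_zero ph hs0 h0
    rw [hsENorm_eq_zero_of_ae_eq_zero]
    · exact zero_le
    · filter_upwards [hz] with x hx
      rw [hx, zero_div]
  rcases eq_or_ne (c1ENorm g) ∞ with hc | hc
  · rw [hc, ENNReal.top_rpow_of_pos (by linarith), add_top, top_add, ENNReal.mul_top (by simp),
      ENNReal.top_mul h0]
    exact le_top
  have D : ReciprocalData b (c1ENorm g).toNNReal (∫⁻ ξ, ‖kh ξ‖ₑ).toNNReal h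
      (fun x => h x / ((g x + b : ℝ) : ℂ)) g kh kg ku := by
    refine ⟨ph, pg, pu, hgb', fun x => ?_, abs_sub_le_c1ENorm_mul hg1 hc.lt_top, ?_⟩
    · have hx : ((g x + b : ℝ) : ℂ) ≠ 0 :=
        Complex.ofReal_ne_zero.2 (lt_of_lt_of_le (by positivity) (hgb' x)).ne'
      exact mul_div_cancel₀ _ hx
    · have hi := integrable_of_besselENorm_lt_top hs ph.2.1 nh
      filter_upwards [ph.ae_enorm_le hi] with x hx
      have := ENNReal.toReal_mono hi.2.ne hx
      rwa [toReal_enorm] at this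
  have hmain := hC D nh ng
  rw [ENNReal.coe_toNNReal hc] at hmain
  have hle : besselENorm s ku ≤ ((C + 1 : ℝ≥0) : ℝ≥0∞) *
      (1 + c1ENorm g ^ s + besselENorm s kg ^ s) * besselENorm s kh := by
    refine hmain.trans ?_
    gcongr
    exact le_self_add
  have hfin : besselENorm s ku < ∞ := by
    refine hmain.trans_lt (ENNReal.mul_lt_top (ENNReal.mul_lt_top ENNReal.coe_lt_top ?_) nh)
    have := ENNReal.rpow_lt_top_of_nonneg hs0 ng.ne
    have := ENNReal.rpow_lt_top_of_nonneg hs0 hc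
    finiteness
  rw [pu.hsENorm_eq hfin]
  exact hle
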